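/- Let $\Gamma$ be a finite simple graph with vertex set $S$, and let $W(\Gamma)$ be the right-angled Coxeter group with generating set $S$, in which distinct generators commute if they are adjacent in $\Gamma$ and generate an infinite dihedral group otherwise. Let $\mathcal B$ be a semi-regular right-angled building of type $\Gamma$, i.e. a building with Weyl distance $\delta\colon \mathcal B\times\mathcal B\to W(\Gamma)$ (we identify $\mathcal B$ with its set of chambers) such that for each $s\in S$ all $s$-panels have the same cardinality $q_s \ge 2$. For each $s$ let $\Omega_s$ be a set of cardinality $q_s$, and fix a legal colouring $\lambda=(\lambda_s)_{s\in S}\colon\mathcal B\to\prod_{s\in S}\Omega_s$: each $\lambda_s$ restricts to a bijection $\mathcal P\to\Omega_s$ on every $s$-panel $\mathcal P$, and is constant on every $t$-panel with $t\neq s$. For $g$ in the group $\mathrm{Aut}(\mathcal B)$ of permutations of $\mathcal B$ that preserve $\delta$ and an $s$-panel $\mathcal P$, the local action of $g$ at $\mathcal P$ is $\lambda_s|_{g\mathcal P}\circ g\circ(\lambda_s|_{\mathcal P})^{-1}\in\mathrm{Sym}(\Omega_s)$. Given $\mathbf F=(F_s)_{s\in S}$ with $F_s\le\mathrm{Sym}(\Omega_s)$,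 the universal group $\mathcal U(\mathbf F)\le\mathrm{Aut}(\mathcal B)$ consists of those automorphisms whose local action at every $s$-panel lies in $F_s$, for all $s\in S$; $\mathcal U(\mathbf F)^+$ denotes the subgroup of $\mathcal U(\mathbf F)$ generated by all chamber stabilizers. For each $s\in S$ let $F_s^+\trianglelefteq F_s$ be the subgroup generated by all point stabilizers, let $Y_s=F_s^+\backslash\Omega_s$ be its set of orbits, write $[x]\in Y_s$ for the orbit of $x\in\Omega_s$, and view $F_s/F_s^+$ as a permutation group on $Y_s$. Let $S'=\{s\in S: |Y_s|>1\}$, let $\Gamma'$ be the subgraph of $\Gamma$ induced on $S'$, let $\mathcal B'$ be a semi-regular right-angled building of type $\Gamma'$ whose $s$-panels have cardinality $|Y_s|$ for each $s\in S'$, with a legal colouring $\lambda'\colon\mathcal B'\to\prod_{s\in S'}Y_s$, and let $\mathcal U(\mathbf F/\mathbf F^+)\le\mathrm{Aut}(\mathcal B')$ be the universal group, with respect to $\lambda'$, with local actions prescribed by $(F_s/F_s^+)_{s\in S'}$. An implosion is a surjective map $\tau\colon\mathcal B\to\mathcal B'$ that is non-expansive for the gallery distances and satisfies $\lambda'_s(\tau(c))=[\lambda_s(c)]$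 for all $c\in\mathcal B$ and $s\in S'$. **Theorem.** 1. For every chamber $c_0\in\mathcal B$ there is a chamber $c_0'\in\mathcal B'$ with $\lambda'_s(c_0')=[\lambda_s(c_0)]$ for all $s\in S'$, and for every such $c_0'$ there is a unique implosion $\tau$ with $\tau(c_0)=c_0'$. 2. For every implosion $\tau\colon\mathcal B\to\mathcal B'$, there is a unique map $\psi\colon\mathcal U(\mathbf F)\to\mathcal U(\mathbf F/\mathbf F^+)$ satisfying $\psi(g).\tau(c)=\tau(g.c)$ for all $g\in\mathcal U(\mathbf F)$ and $c\in\mathcal B$. This map $\psi$ is a surjective group homomorphism, with kernel exactly $\mathcal U(\mathbf F)^+$. 3. In particular, $\mathcal U(\mathbf F)/\mathcal U(\mathbf F)^+\cong\mathcal U(\mathbf F/\mathbf F^+)$. -/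

import Mathlib

universe u v w x

noncomputable section

/-! ### Coxeter groups of right-angled type and buildings -/

open Classical in
/-- The Coxeter matrix of the right-angled Coxeter group `W(Γ)`: two distinct generators commute if
they are adjacent in `Γ`, and satisfy no relation otherwise (the entry `0` encodes `∞`). -/
def rightAngledMatrix {S : Type u} (Γ : SimpleGraph S) : CoxeterMatrix S where
  M := Matrix.of fun s t => if s = t then 1 else if Γ.Adj s t then 2 else 0
  isSymm := by
    ext s t
    simp only [Matrix.transpose_apply, Matrix.of_apply, eq_comm (a := t), Γ.adj_comm t s]
  diagonal := by simp
  off_diagonal := by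
    intro s t h
    simp only [Matrix.of_apply, if_neg h]
    split_ifs <;> decide

/-- A building of type `(W, S)`, where `W` is the Coxeter group of the Coxeter matrix `M`: a
nonempty set `C` of chambers with a Weyl distance `δ : C × C → W`. -/
structure Building {S : Type u} (M : CoxeterMatrix S) (C : Type v) where
  δ : C → C → M.Group
  nonempty : Nonempty C
  δ_eq_one_iff : ∀ c d, δ c d = 1 ↔ c = d
  δ_adj : ∀ s c c' d, δ c' c = M.simple s →
    δ c' d = M.simple s * δ c d ∨ δ c' d = δ c d
  δ_adj_of_length : ∀ s c c' d, δ c' c = M.simple s →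
    M.toCoxeterSystem.length (M.simple s * δ c d) = M.toCoxeterSystem.length (δ c d) + 1 →
    δ c' d = M.simple s * δ c d
  exists_adj : ∀ s c d, ∃ c', δ c' c = M.simple s ∧ δ c' d = M.simple s * δ c d

namespace Building

variable {S : Type u} {M : CoxeterMatrix S} {C : Type v} (B : Building M C)

/-- The `s`-panel containing the chamber `c`: all chambers that are equal or `s`-adjacent to `c`. -/
def panel (s : S) (c : C) : Set C := {d | B.δ c d = 1 ∨ B.δ c d = M.simple s}

/-- The numerical (gallery) distance between two chambers. -/
def dist (c d : C) : ℕ := M.toCoxeterSystem.length (B.δ c d)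

/-- The group of (type-preserving) automorphisms of a building. -/
def Aut : Subgroup (Equiv.Perm C) where
  carrier := {g | ∀ c d, B.δ (g c) (g d) = B.δ c d}
  one_mem' := fun _ _ => rfl
  mul_mem' := fun {g h} hg hh c d => (hg (h c) (h d)).trans (hh c d)
  inv_mem' := fun {g} hg c d => by
    have := hg (g⁻¹ c) (g⁻¹ d)
    simpa using this.symm

/-- An automorphism maps the `s`-panel of `c` bijectively to the `s`-panel of its image. -/
def autPanelEquiv (g : B.Aut) (s : S) (c : C) : B.panel s c ≃ B.panel s (g • c) :=
  Equiv.subtypeEquiv (g : Equiv.Perm C) fun d => by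
    change _ ↔ B.δ ((g : Equiv.Perm C) c) ((g : Equiv.Perm C) d) = 1 ∨
      B.δ ((g : Equiv.Perm C) c) ((g : Equiv.Perm C) d) = M.simple s
    rw [g.2 c d]
    rfl

end Building

/-! ### Legal colourings and universal groups -/

/-- A legal colouring with colour sets `Ω s`: the colour `colour c s` restricts to a bijection from
each `s`-panel to `Ω s`, and is constant on each `t`-panel with `t ≠ s`. Its existence
forces all `s`-panels to have the cardinality of `Ω s`, i.e. the building is semi-regular. -/
structure LegalColouring {S : Type u} {M : CoxeterMatrix S} {C : Type v} (B : Building M C)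
    (Ω : S → Type w) where
  colour : C → ∀ s, Ω s
  bijOn : ∀ s c, Set.BijOn (fun d => colour d s) (B.panel s c) Set.univ
  const : ∀ s t, t ≠ s → ∀ c, ∀ d ∈ B.panel t c, colour d s = colour c s

namespace LegalColouring

variable {S : Type u} {M : CoxeterMatrix S} {C : Type v} {B : Building M C} {Ω : S → Type w}
  (lam : LegalColouring B Ω)

/-- The bijection from the `s`-panel of `c` to the colour set given by the `s`-colour. -/
def panelEquiv (s : S) (c : C) : B.panel s c ≃ Ω s :=
  ((lam.bijOn s c).equiv _).trans (Equiv.Set.univ (Ω s))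

/-- The local action of `g` at the `s`-panel `P` of `c`: the permutation
`λ_s|_{gP} ∘ g ∘ (λ_s|_P)⁻¹` of the colour set. -/
def localAction (g : B.Aut) (s : S) (c : C) : Equiv.Perm (Ω s) :=
  ((lam.panelEquiv s c).symm.trans (B.autPanelEquiv g s c)).trans (lam.panelEquiv s (g • c))

theorem localAction_mul (g h : B.Aut) (s : S) (c : C) :
    lam.localAction (g * h) s c = lam.localAction g s (h • c) * lam.localAction h s c := by
  ext a
  simp only [localAction, Equiv.Perm.mul_apply, Equiv.trans_apply, Equiv.symm_apply_apply]
  rfl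

theorem localAction_one (s : S) (c : C) : lam.localAction 1 s c = 1 := by
  ext a
  obtain ⟨d, rfl⟩ := (lam.panelEquiv s c).surjective a
  simp only [localAction, Equiv.trans_apply, Equiv.symm_apply_apply]
  rfl

/-- The universal group `U(F)`: all automorphisms whose local action at every `s`-panel belongs to
the prescribed permutation group `F s`, for all `s`. -/
def universalGroup (F : ∀ s, Subgroup (Equiv.Perm (Ω s))) : Subgroup B.Aut where
  carrier := {g | ∀ s c, lam.localAction g s c ∈ F s}
  one_mem' := fun s c => by rw [localAction_one]; exact one_mem _
  mul_mem' := fun {g h} hg hh s c => by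
    rw [localAction_mul]; exact mul_mem (hg _ _) (hh _ _)
  inv_mem' := fun {g} hg s c => by
    have h := lam.localAction_mul g g⁻¹ s c
    rw [mul_inv_cancel, localAction_one] at h
    rw [← inv_eq_of_mul_eq_one_right h.symm]
    exact inv_mem (hg _ _)

end LegalColouring

/-! ### The subgroup generated by point stabilizers and its quotient -/

/-- For a group `G` acting on `X`, the subgroup `G⁺` generated by all point stabilizers. -/
def stabilizersSubgroup (G : Type u) [Group G] (X : Type v) [MulAction G X] : Subgroup G :=
  ⨆ a : X, MulAction.stabilizer G a

instance stabilizersSubgroup_normal (G : Type u) [Group G] (X : Type v) [MulAction G X] :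
    (stabilizersSubgroup G X).Normal where
  conj_mem := fun n hn g => by
    have key : stabilizersSubgroup G X ≤
        (stabilizersSubgroup G X).comap (MulAut.conj g).toMonoidHom := by
      refine iSup_le fun a h hh => ?_
      refine (le_iSup (fun a : X => MulAction.stabilizer G a) (g • a)) ?_
      rw [MulAction.mem_stabilizer_iff] at hh ⊢
      simp [mul_smul, hh]
    exact key hn

/-- For a normal subgroup `N` of `G`, the induced action of `G` on the set of `N`-orbits. -/
def orbitsPermHom {G : Type u} [Group G] (N : Subgroup G) [N.Normal] (X : Type v)
    [MulAction G X] : G →* Equiv.Perm (MulAction.orbitRel.Quotient N X) :=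
  letI : MulAction G (MulAction.orbitRel.Quotient N X) :=
    { smul := fun g => Quotient.map (fun a => g • a) (by
        rintro a b ⟨n, rfl⟩
        refine ⟨⟨g * n * g⁻¹, Subgroup.Normal.conj_mem ‹N.Normal› n n.2 g⟩, ?_⟩
        simp [Subgroup.smul_def, mul_smul])
      one_smul := by
        rintro ⟨a⟩
        exact congrArg (Quotient.mk _) (one_smul G a)
      mul_smul := by
        rintro g h ⟨a⟩
        exact congrArg (Quotient.mk _) (mul_smul g h a) }
  MulAction.toPermHom G (MulAction.orbitRel.Quotient N X)

section Orbits

variable {Ω : Type w} (F : Subgroup (Equiv.Perm Ω))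

/-- The equivalence relation on `Ω` whose classes are the orbits of `F⁺`. -/
def plusSetoid : Setoid Ω := MulAction.orbitRel (stabilizersSubgroup F Ω) Ω

/-- The action of the quotient group `F/F⁺` on the set of `F⁺`-orbits. -/
def quotientPermHom : F ⧸ stabilizersSubgroup F Ω →* Equiv.Perm (Quotient (plusSetoid F)) :=
  QuotientGroup.lift (stabilizersSubgroup F Ω) (orbitsPermHom (stabilizersSubgroup F Ω) Ω) (by
    intro n hn
    ext ⟨a⟩
    exact Quotient.sound ⟨⟨n, hn⟩, rfl⟩)

/-- The quotient `F/F⁺` viewed as a permutation group on the set of `F⁺`-orbits. -/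
def quotientPermGroup : Subgroup (Equiv.Perm (Quotient (plusSetoid F))) :=
  (quotientPermHom F).range

end Orbits

/-! ### Implosions -/

/-- For equivalence relations on the colour sets, the set `S'` of all `s` such that there is more
than one equivalence class of `s`-colours. -/
def essentialTypes {S : Type u} {Ω : S → Type w} (r : ∀ s, Setoid (Ω s)) : Set S :=
  {s | Nontrivial (Quotient (r s))}

/-- The colour sets of the imploded building: the sets of equivalence classes, for `s ∈ S'`. -/
abbrev ImplodedColours {S : Type u} {Ω : S → Type w} (r : ∀ s, Setoid (Ω s)) :
    essentialTypes r → Type w :=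
  fun s => Quotient (r s)

/-- The Coxeter matrix of the imploded building: the type is the subgraph of `Γ` induced on `S'`. -/
abbrev implodedMatrix {S : Type u} (Γ : SimpleGraph S) {Ω : S → Type w} (r : ∀ s, Setoid (Ω s)) :
    CoxeterMatrix (essentialTypes r) :=
  rightAngledMatrix (Γ.induce (essentialTypes r))

/-- The colour `λ'_s(c')` equals the class of the colour `λ_s(c)`, for all `s ∈ S'`. -/
def SameColours {S : Type u} {Γ : SimpleGraph S} {C : Type v} {C' : Type x} {Ω : S → Type w}
    {B : Building (rightAngledMatrix Γ) C} (lam : LegalColouring B Ω) {r : ∀ s, Setoid (Ω s)}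
    {B' : Building (implodedMatrix Γ r) C'} (lam' : LegalColouring B' (ImplodedColours r))
    (c : C) (c' : C') : Prop :=
  ∀ s : essentialTypes r, lam'.colour c' s = Quotient.mk (r s) (lam.colour c s)

/-- An implosion is a non-expansive surjective map that preserves colours. -/
structure IsImplosion {S : Type u} {Γ : SimpleGraph S} {C : Type v} {C' : Type x} {Ω : S → Type w}
    {B : Building (rightAngledMatrix Γ) C} (lam : LegalColouring B Ω) {r : ∀ s, Setoid (Ω s)}
    {B' : Building (implodedMatrix Γ r) C'} (lam' : LegalColouring B' (ImplodedColours r))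
    (τ : C → C') : Prop where
  nonexpansive : ∀ c d, B'.dist (τ c) (τ d) ≤ B.dist c d
  surjective : Function.Surjective τ
  colour : ∀ c, SameColours lam lam' c (τ c)

end

noncomputable section

/-! ### Homomorphisms out of `W(Γ)` -/

namespace RightAngled

variable {S : Type u} {Γ : SimpleGraph S}

/-! Write `move s a c` for the chamber of colour `a` in the `s`-panel of `c`. Moves of adjacent
types commute, two moves of the same type collapse to the last one, moving to the present colour
does nothing, and every chamber is reached from any other by moves. The engine of the proof is that
these relations suffice: a set with operations that satisfy them receives an equivariant map from
the building, with one value prescribed (`RightAngled.exists_equivariant`). Follow minimal galleries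
to define the map. Two minimal galleries to the same chamber differ by swaps of commuting letters,
because two distinct left descents of an element of `W(Γ)` always commute
(`RightAngled.adj_of_descents`).

Three targets give the theorem. With target the building itself and colours twisted by permutations,
one gets automorphisms with prescribed constant local actions. With target `B'`, where moves of
inessential type act trivially, one gets implosions, since these are exactly the colour-compatible
equivariant maps. With source `B'` and target the set of `U(F)⁺`-orbits of chambers of `B`, one gets
a map through which the orbit projection factors, so each fibre of an implosion lies in one orbit.

Because `F s / (F s)⁺` acts freely on classes of colours, an element of `U(F)` has the same local
action modulo `(F s)⁺` at all `s`-panels. Hence it descends along an implosion, elements of the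
target group lift, and chamber stabilizers act trivially below. The statement on fibres gives the
other inclusion for the kernel. -/

theorem rightAngledMatrix_self (s : S) : (rightAngledMatrix Γ).M s s = 1 := by
  simp [rightAngledMatrix]

theorem rightAngledMatrix_of_adj {s t : S} (h : Γ.Adj s t) : (rightAngledMatrix Γ).M s t = 2 := by
  simp [rightAngledMatrix, h, h.ne]

theorem rightAngledMatrix_of_not_adj {s t : S} (hne : s ≠ t) (h : ¬ Γ.Adj s t) :
    (rightAngledMatrix Γ).M s t = 0 := by
  simp [rightAngledMatrix, h, hne]

/-- Involutions that commute along the edges of `Γ` satisfy the relations of `W(Γ)`. -/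
theorem isLiftable {G : Type*} [Monoid G] (f : S → G) (hsq : ∀ s, f s * f s = 1)
    (hcomm : ∀ s t, Γ.Adj s t → f s * f t = f t * f s) :
    (rightAngledMatrix Γ).IsLiftable f := by
  intro s t
  rcases eq_or_ne s t with rfl | hne
  · rw [rightAngledMatrix_self, pow_one, hsq]
  by_cases h : Γ.Adj s t
  · rw [rightAngledMatrix_of_adj h, pow_two, mul_assoc, ← mul_assoc (f t), ← hcomm s t h,
      mul_assoc (f s), hsq, mul_one, hsq]
  · rw [rightAngledMatrix_of_not_adj hne h, pow_zero]

/-- The homomorphism from `W(Γ)` given by involutions that commute along the edges of `Γ`. -/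
def lift {G : Type*} [Monoid G] (f : S → G) (hsq : ∀ s, f s * f s = 1)
    (hcomm : ∀ s t, Γ.Adj s t → f s * f t = f t * f s) : (rightAngledMatrix Γ).Group →* G :=
  (rightAngledMatrix Γ).toCoxeterSystem.lift ⟨f, isLiftable f hsq hcomm⟩

theorem lift_simple {G : Type*} [Monoid G] (f : S → G) (hsq : ∀ s, f s * f s = 1)
    (hcomm : ∀ s t, Γ.Adj s t → f s * f t = f t * f s) (s : S) :
    lift f hsq hcomm ((rightAngledMatrix Γ).simple s) = f s := by
  rw [← CoxeterMatrix.toCoxeterSystem_simple]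
  exact CoxeterSystem.lift_apply_simple _ _ s

end RightAngled

/-! ### Word length in a Coxeter group -/

namespace CoxeterMatrix

variable {S : Type u} (M : CoxeterMatrix S)

/-- The word length in the Coxeter group of `M`. -/
abbrev len (w : M.Group) : ℕ := M.toCoxeterSystem.length w

theorem simple_mul_self (s : S) : M.simple s * M.simple s = 1 :=
  M.toCoxeterSystem.simple_mul_simple_self s

theorem simple_mul_cancel (s : S) (w : M.Group) : M.simple s * (M.simple s * w) = w := by
  rw [← mul_assoc, simple_mul_self, one_mul]

theorem simple_inv (s : S) : (M.simple s)⁻¹ = M.simple s :=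
  M.toCoxeterSystem.inv_simple s

theorem len_simple (s : S) : M.len (M.simple s) = 1 :=
  M.toCoxeterSystem.length_simple s

theorem simple_ne_one (s : S) : M.simple s ≠ 1 := fun h => by
  have := M.len_simple s
  rw [h] at this
  simp [len] at this

theorem len_simple_mul (s : S) (w : M.Group) :
    M.len (M.simple s * w) = M.len w + 1 ∨ M.len (M.simple s * w) + 1 = M.len w :=
  M.toCoxeterSystem.length_simple_mul w s

theorem len_eq_zero_iff {w : M.Group} : M.len w = 0 ↔ w = 1 :=
  M.toCoxeterSystem.length_eq_zero_iff

theorem len_eq_one_iff {w : M.Group} : M.len w = 1 ↔ ∃ s, w = M.simple s :=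
  M.toCoxeterSystem.length_eq_one_iff

theorem exists_len_simple_mul_lt {w : M.Group} (hw : w ≠ 1) :
    ∃ s, M.len (M.simple s * w) + 1 = M.len w := by
  obtain ⟨s, hs⟩ := M.toCoxeterSystem.exists_leftDescent_of_ne_one hw
  exact ⟨s, M.toCoxeterSystem.isLeftDescent_iff.1 hs⟩

theorem group_induction {p : M.Group → Prop} (w : M.Group) (one : p 1)
    (simple_mul : ∀ s w, p w → p (M.simple s * w)) : p w :=
  M.toCoxeterSystem.simple_induction_left w one fun w s h => simple_mul s w h

end CoxeterMatrix

/-! ### Inversions, and commutation of descents -/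

namespace RightAngled

variable {S : Type u} {Γ : SimpleGraph S}

local notation "W" => CoxeterMatrix.Group (rightAngledMatrix Γ)
local notation "σ" => CoxeterMatrix.simple (rightAngledMatrix Γ)
local notation "ℓ" => CoxeterMatrix.len (rightAngledMatrix Γ)

theorem simple_comm {s t : S} (h : Γ.Adj s t) : σ s * σ t = σ t * σ s := by
  have h2 := (rightAngledMatrix Γ).toCoxeterSystem.simple_mul_simple_pow s t
  change (σ s * σ t) ^ (rightAngledMatrix Γ).M s t = 1 at h2
  rw [rightAngledMatrix_of_adj h, pow_two] at h2
  rw [eq_inv_of_mul_eq_one_left h2, mul_inv_rev, CoxeterMatrix.simple_inv,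
    CoxeterMatrix.simple_inv]

-- The homomorphism to `ZMod 2` counting occurrences of `s` modulo 2 separates `s` from every other
-- generator.
open Classical in
theorem simple_injective : Function.Injective (σ : S → W) := by
  intro s t h
  by_contra hne
  let f : S → Multiplicative (ZMod 2) := fun i => if i = s then Multiplicative.ofAdd 1 else 1
  have key := congrArg (lift (Γ := Γ) f
    (fun i => by dsimp only [f]; split_ifs <;> decide) fun _ _ _ => mul_comm _ _) h
  rw [lift_simple, lift_simple] at key
  simp only [f, if_true, if_neg (Ne.symm hne)] at key
  revert key
  decide

open Classical in
/-- The action of a generator on functions `W → ZMod 2` from which the inversion indicator is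
obtained. -/
def inversionStep (s : S) : Function.End (W → ZMod 2) :=
  fun f r => (if r = σ s then 1 else 0) + f (σ s * r * σ s)

theorem inversionStep_apply_self (s : S) :
    (inversionStep s * inversionStep s : Function.End (W → ZMod 2)) = 1 := by
  classical
  funext f r
  change _ + (_ + f _) = f r
  have h1 : σ s * r * σ s = σ s ↔ r = σ s := by
    rw [mul_assoc, mul_eq_left, mul_eq_one_iff_eq_inv, CoxeterMatrix.simple_inv]
  have h2 : σ s * (σ s * r * σ s) * σ s = r := by
    rw [mul_assoc (σ s) r, CoxeterMatrix.simple_mul_cancel, mul_assoc,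
      CoxeterMatrix.simple_mul_self, mul_one]
  rw [if_congr h1 rfl rfl, h2, ← add_assoc, CharTwo.add_self_eq_zero, zero_add]

theorem inversionStep_comm {s t : S} (h : Γ.Adj s t) :
    (inversionStep s * inversionStep t : Function.End (W → ZMod 2)) =
      inversionStep t * inversionStep s := by
  classical
  funext f r
  change _ + (_ + f _) = _ + (_ + f _)
  have conj : ∀ {a b : S}, Γ.Adj a b → (σ a * r * σ a = σ b ↔ r = σ b) := by
    intro a b hab
    rw [mul_assoc, ← CoxeterMatrix.simple_inv, inv_mul_eq_iff_eq_mul, CoxeterMatrix.simple_inv,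
      simple_comm hab]
    exact mul_left_inj _
  have h2 : σ t * (σ s * r * σ s) * σ t = σ s * (σ t * r * σ t) * σ s := by
    simp only [mul_assoc]
    rw [simple_comm h, ← mul_assoc (σ t), ← mul_assoc (σ s), simple_comm h]
  rw [if_congr (conj h) rfl rfl, if_congr (conj h.symm) rfl rfl, h2]
  ring

/-- The indicator of the left inversions of `w`. -/
def inversion (w : W) : W → ZMod 2 :=
  lift (G := Function.End (W → ZMod 2)) inversionStep inversionStep_apply_self
    (fun _ _ h => inversionStep_comm h) w 0

theorem inversion_one (r : W) : inversion (1 : W) r = 0 := by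
  rw [inversion, map_one]
  rfl

open Classical in
theorem inversion_simple_mul (s : S) (w r : W) :
    inversion (σ s * w) r = (if r = σ s then 1 else 0) + inversion w (σ s * r * σ s) := by
  rw [inversion, map_mul, lift_simple]
  rfl

/-- The cocycle rule: a prefix `u` contributes its own inversions, and the remainder contributes its
inversions conjugated by `u`. -/
theorem inversion_mul (u w r : W) :
    inversion (u * w) r = inversion u r + inversion w (u⁻¹ * r * u) := by
  induction u using CoxeterMatrix.group_induction generalizing r with
  | one => simp [inversion_one]
  | simple_mul s u ih =>
    rw [mul_assoc, inversion_simple_mul, inversion_simple_mul, ih, add_assoc, mul_inv_rev,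
      CoxeterMatrix.simple_inv]
    simp only [mul_assoc]

/-- One half of the strong exchange condition. Strip a left descent `s` from `w`: either `r` is that
generator, or its conjugate by `s` is an inversion of the shorter element. -/
theorem len_mul_lt_of_inversion_ne_zero {w r : W} (h : inversion w r ≠ 0) : ℓ (r * w) < ℓ w := by
  classical
  induction hn : ℓ w using Nat.strong_induction_on generalizing w r with
  | _ n ih =>
    have hw : w ≠ 1 := by
      rintro rfl
      exact h (inversion_one r)
    obtain ⟨s, hs⟩ := CoxeterMatrix.exists_len_simple_mul_lt _ hw
    obtain ⟨v, rfl⟩ : ∃ v, w = σ s * v :=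
      ⟨σ s * w, (CoxeterMatrix.simple_mul_cancel _ s w).symm⟩
    rw [CoxeterMatrix.simple_mul_cancel] at hs
    rw [inversion_simple_mul] at h
    by_cases hr : r = σ s
    · rw [hr, CoxeterMatrix.simple_mul_cancel]
      omega
    · rw [if_neg hr, zero_add] at h
      have := ih (ℓ v) (by omega) h rfl
      have e : r * (σ s * v) = σ s * (σ s * r * σ s * v) := by
        simp only [mul_assoc]
        rw [CoxeterMatrix.simple_mul_cancel]
      rw [e]
      rcases (rightAngledMatrix Γ).len_simple_mul s (σ s * r * σ s * v) with h | h <;> omega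

/-- For the converse, left multiplication by `s` toggles the indicator at `s`, so if it vanished at
`w`, then `s` would shorten `s * w` to `w`. -/
theorem inversion_simple_ne_zero_iff {w : W} {s : S} :
    inversion w (σ s) ≠ 0 ↔ ℓ (σ s * w) < ℓ w := by
  classical
  refine ⟨len_mul_lt_of_inversion_ne_zero, fun h h0 => ?_⟩
  have : inversion (σ s * w) (σ s) ≠ 0 := by
    rw [inversion_simple_mul, if_pos rfl, CoxeterMatrix.simple_mul_self, one_mul, h0]
    decide
  have := len_mul_lt_of_inversion_ne_zero this
  rw [CoxeterMatrix.simple_mul_cancel] at this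
  omega

theorem len_simple_mul_lt_of_adj {w : W} {s t : S} (hst : Γ.Adj s t)
    (ht : ℓ (σ t * w) < ℓ w) :
    ℓ (σ t * (σ s * w)) < ℓ (σ s * w) := by
  classical
  rw [← inversion_simple_ne_zero_iff] at ht ⊢
  rwa [inversion_simple_mul, if_neg fun h => hst.ne (simple_injective h).symm, zero_add,
    simple_comm hst, mul_assoc, CoxeterMatrix.simple_mul_self, mul_one]

-- Let `s` and `t` act on `ℤ` as the reflections `x ↦ -x` and `x ↦ 1 - x`, and all other generators
-- trivially. Then `s * t` is a translation by `-1`.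
open Classical in
theorem zpow_simple_mul_simple_eq_one {s t : S} (hne : s ≠ t) (hst : ¬ Γ.Adj s t) {k : ℤ}
    (h : (σ s * σ t) ^ k = 1) : k = 0 := by
  let f : S → Equiv.Perm ℤ := fun i =>
    if i = s then Equiv.neg ℤ else if i = t then Equiv.subLeft 1 else 1
  have hsq : ∀ i, f i * f i = 1 := by
    intro i
    ext x
    dsimp only [f]
    split_ifs <;> simp
  have hcomm : ∀ i j, Γ.Adj i j → f i * f j = f j * f i := by
    intro i j hij
    have h1 : ∀ i, i ≠ s → i ≠ t → f i = 1 := fun i h h' => by simp [f, h, h']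
    by_cases hi : i ≠ s ∧ i ≠ t
    · rw [h1 i hi.1 hi.2, one_mul, mul_one]
    by_cases hj : j ≠ s ∧ j ≠ t
    · rw [h1 j hj.1 hj.2, one_mul, mul_one]
    have : i = j := by
      by_contra hne'
      have h2 := hij.symm
      grind
    rw [this]
  have key := congrArg (lift (Γ := Γ) f hsq hcomm) h
  rw [map_zpow, map_mul, lift_simple, lift_simple, map_one] at key
  have e : ∀ x, (f s * f t) x = x - 1 := by
    intro x
    simp [f, hne.symm]
  have e' : ∀ (k x : ℤ), ((f s * f t) ^ k) x = x - k := by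
    intro k
    induction k with
    | zero => simp
    | succ k ih =>
      intro x
      rw [zpow_add_one, Equiv.Perm.mul_apply, e, ih]
      ring
    | pred k ih =>
      intro x
      have h1 : (f s * f t)⁻¹ x = x + 1 := by
        rw [Equiv.Perm.inv_eq_iff_eq, e, add_sub_cancel_right]
      rw [zpow_sub_one, Equiv.Perm.mul_apply, h1, ih]
      ring
  have := e' k 0
  rw [key] at this
  simpa using this.symm

/-- The reflections of the infinite dihedral group are `(st)^k s`, ordered along a line by `k`, with
`s` at `k = 0` and `t` at `k = -1`. Those inverted by `u` form an interval of `|z|` of them on one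
side of the base point between `s` and `t`, so `s` and `t` are never both inverted. -/
theorem exists_inversion_dihedral {s t : S} (hne : s ≠ t) (hst : ¬ Γ.Adj s t) {u : W}
    (hu : u ∈ Subgroup.closure {σ s, σ t}) :
    ∃ z : ℤ, ∀ k : ℤ, inversion u ((σ s * σ t) ^ k * σ s) =
      if (0 ≤ k ∧ z ≤ -k - 1) ∨ (k < 0 ∧ -k ≤ z) then 1 else 0 := by
  classical
  have hinv : σ t * σ s = (σ s * σ t)⁻¹ := by
    rw [mul_inv_rev, CoxeterMatrix.simple_inv, CoxeterMatrix.simple_inv]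
  have conj_s : ∀ k : ℤ, σ s * ((σ s * σ t) ^ k * σ s) * σ s = (σ s * σ t) ^ (-k) * σ s := by
    intro k
    have h := conj_zpow (a := σ s) (b := σ s * σ t) (i := k)
    rw [CoxeterMatrix.simple_inv, CoxeterMatrix.simple_mul_cancel, hinv, inv_zpow'] at h
    rw [h]
    simp only [mul_assoc, CoxeterMatrix.simple_mul_self, mul_one]
  have conj_t : ∀ k : ℤ, σ t * ((σ s * σ t) ^ k * σ s) * σ t = (σ s * σ t) ^ (-k - 2) * σ s := by
    intro k
    have h := conj_zpow (a := σ t) (b := σ s * σ t) (i := k)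
    rw [CoxeterMatrix.simple_inv, mul_assoc (σ t), mul_assoc (σ s), CoxeterMatrix.simple_mul_self,
      mul_one, hinv, inv_zpow'] at h
    have e : σ t * ((σ s * σ t) ^ k * σ s) * σ t
        = (σ t * (σ s * σ t) ^ k * σ t) * (σ t * σ s) * σ t := by
      simp only [mul_assoc, CoxeterMatrix.simple_mul_cancel]
    have e2 : (σ s * σ t)⁻¹ * σ t = (σ s * σ t) ^ (-2 : ℤ) * σ s := by
      rw [zpow_neg, zpow_two, mul_inv_rev (σ s * σ t), ← hinv]
      simp only [mul_assoc, CoxeterMatrix.simple_mul_self, mul_one]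
    rw [e, ← h, hinv, mul_assoc, e2, ← mul_assoc, ← zpow_add]
    rfl
  have eq_s : ∀ k : ℤ, (σ s * σ t) ^ k * σ s = σ s ↔ k = 0 := by
    intro k
    rw [mul_eq_right]
    exact ⟨zpow_simple_mul_simple_eq_one hne hst, fun h => by rw [h, zpow_zero]⟩
  have eq_t : ∀ k : ℤ, (σ s * σ t) ^ k * σ s = σ t ↔ k = -1 := by
    intro k
    have : (σ s * σ t) ^ k * σ s = σ t ↔ (σ s * σ t) ^ (k + 1) = 1 := by
      rw [zpow_add_one, ← mul_assoc, mul_eq_one_iff_eq_inv, CoxeterMatrix.simple_inv]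
    rw [this]
    refine ⟨fun h => ?_, fun h => by rw [h]; rfl⟩
    have := zpow_simple_mul_simple_eq_one hne hst h
    omega
  have step_s : ∀ u : W, (∃ z : ℤ, ∀ k : ℤ, inversion u ((σ s * σ t) ^ k * σ s) =
      if (0 ≤ k ∧ z ≤ -k - 1) ∨ (k < 0 ∧ -k ≤ z) then 1 else 0) →
      ∃ z : ℤ, ∀ k : ℤ, inversion (σ s * u) ((σ s * σ t) ^ k * σ s) =
      if (0 ≤ k ∧ z ≤ -k - 1) ∨ (k < 0 ∧ -k ≤ z) then 1 else 0 := by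
    rintro u ⟨z, hz⟩
    refine ⟨-1 - z, fun k => ?_⟩
    rw [inversion_simple_mul, conj_s, hz, eq_s]
    split_ifs <;> first | rfl | (exfalso; omega)
  have step_t : ∀ u : W, (∃ z : ℤ, ∀ k : ℤ, inversion u ((σ s * σ t) ^ k * σ s) =
      if (0 ≤ k ∧ z ≤ -k - 1) ∨ (k < 0 ∧ -k ≤ z) then 1 else 0) →
      ∃ z : ℤ, ∀ k : ℤ, inversion (σ t * u) ((σ s * σ t) ^ k * σ s) =
      if (0 ≤ k ∧ z ≤ -k - 1) ∨ (k < 0 ∧ -k ≤ z) then 1 else 0 := by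
    rintro u ⟨z, hz⟩
    refine ⟨1 - z, fun k => ?_⟩
    rw [inversion_simple_mul, conj_t, hz, eq_t]
    split_ifs <;> first | rfl | (exfalso; omega)
  induction hu using Subgroup.closure_induction_left with
  | one =>
    refine ⟨0, fun k => ?_⟩
    rw [inversion_one, if_neg (by omega)]
  | mul_left a ha u _ ih =>
    rcases ha with rfl | rfl
    · exact step_s u ih
    · exact step_t u ih
  | inv_mul_cancel a ha u _ ih =>
    rcases ha with rfl | rfl
    · rw [CoxeterMatrix.simple_inv]; exact step_s u ih
    · rw [CoxeterMatrix.simple_inv]; exact step_t u ih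

theorem adj_of_descents {w : W} {s t : S} (hne : s ≠ t)
    (hs : ℓ (σ s * w) < ℓ w) (ht : ℓ (σ t * w) < ℓ w) : Γ.Adj s t := by
  classical
  by_contra hst
  let D : Subgroup W := Subgroup.closure {σ s, σ t}
  -- Pass to a shortest element `u⁻¹ * w` of the coset `D w`. It has no inversion in `D`, so on `D`
  -- the inversions of `w` are those of `u`.
  obtain ⟨u, hu⟩ := exists_minimal_of_wellFoundedLT (fun n => ∃ u ∈ D, ℓ (u⁻¹ * w) = n)
    ⟨_, 1, one_mem _, rfl⟩
  obtain ⟨⟨u, huD, rfl⟩, hmin⟩ := hu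
  have hsD : σ s ∈ D := Subgroup.subset_closure (by simp)
  have htD : σ t ∈ D := Subgroup.subset_closure (by simp)
  have hx : ∀ r ∈ D, inversion w r = inversion u r := by
    intro r hr
    have h1 := inversion_mul u (u⁻¹ * w) r
    rw [mul_inv_cancel_left] at h1
    rw [h1, add_eq_left]
    by_contra h2
    have h3 := len_mul_lt_of_inversion_ne_zero h2
    have hr' : u⁻¹ * r * u ∈ D := mul_mem (mul_mem (inv_mem huD) hr) huD
    have := hmin ⟨u * (u⁻¹ * r * u)⁻¹, mul_mem huD (inv_mem hr'), rfl⟩ (by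
      rw [mul_inv_rev, inv_inv, mul_assoc]
      exact h3.le)
    rw [mul_inv_rev, inv_inv, mul_assoc] at this
    omega
  obtain ⟨z, hz⟩ := exists_inversion_dihedral hne hst huD
  have h0 := hz 0
  have h1 := hz (-1)
  have e : (σ s * σ t) ^ (-1 : ℤ) * σ s = σ t := by
    rw [zpow_neg_one, mul_inv_rev, CoxeterMatrix.simple_inv, CoxeterMatrix.simple_inv, mul_assoc,
      CoxeterMatrix.simple_mul_self, mul_one]
  rw [zpow_zero, one_mul, ← hx _ hsD] at h0
  rw [e, ← hx _ htD] at h1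
  rw [← inversion_simple_ne_zero_iff] at hs ht
  rw [h0] at hs
  rw [h1] at ht
  split_ifs at hs ht <;> first | omega | exact hs rfl | exact ht rfl

end RightAngled

/-! ### Panels, projections and gallery distance -/

namespace Building

variable {S : Type u} {M : CoxeterMatrix S} {C : Type v} (B : Building M C)

theorem δ_self (c : C) : B.δ c c = 1 := (B.δ_eq_one_iff c c).2 rfl

theorem δ_symm_simple {s : S} {c d : C} (h : B.δ c d = M.simple s) : B.δ d c = M.simple s := by
  rcases B.δ_adj s d c c h with h' | h'
  · rw [δ_self] at h'
    rw [eq_inv_of_mul_eq_one_right h'.symm, M.simple_inv]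
  · rw [δ_self, eq_comm, δ_eq_one_iff] at h'
    rw [h', δ_self] at h
    exact absurd h.symm (M.simple_ne_one s)

theorem mem_panel_self (s : S) (c : C) : c ∈ B.panel s c := Or.inl (B.δ_self c)

theorem mem_panel_symm {s : S} {c d : C} (h : d ∈ B.panel s c) : c ∈ B.panel s d := by
  rcases h with h | h
  · rw [(B.δ_eq_one_iff c d).1 h]
    exact B.mem_panel_self s d
  · exact Or.inr (B.δ_symm_simple h)

theorem mem_panel_trans {s : S} {c d e : C} (h : d ∈ B.panel s c) (h' : e ∈ B.panel s d) :
    e ∈ B.panel s c := by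
  rcases h with h | h
  · rwa [(B.δ_eq_one_iff c d).1 h]
  rcases h' with h' | h'
  · rw [← (B.δ_eq_one_iff d e).1 h']
    exact Or.inr h
  rcases B.δ_adj s d c e h with h2 | h2
  · rw [h', M.simple_mul_self] at h2
    exact Or.inl h2
  · exact Or.inr (h2.trans h')

theorem δ_of_mem_panel {s : S} {c c' : C} (h : c' ∈ B.panel s c) (d : C) :
    B.δ c' d = M.simple s * B.δ c d ∨ B.δ c' d = B.δ c d := by
  rcases h with h | h
  · rw [(B.δ_eq_one_iff c c').1 h]
    exact Or.inr rfl
  · exact B.δ_adj s c c' d (B.δ_symm_simple h)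

theorem dist_le_of_mem_panel {s : S} {c c' : C} (h : c' ∈ B.panel s c) (d : C) :
    B.dist c' d ≤ B.dist c d + 1 := by
  change M.len (B.δ c' d) ≤ M.len (B.δ c d) + 1
  rcases B.δ_of_mem_panel h d with h | h
  · rcases M.len_simple_mul s (B.δ c d) with h' | h' <;> rw [h] <;> omega
  · rw [h]
    omega

theorem δ_of_mem_panel_of_dist {s : S} {c c' d : C} (h : c' ∈ B.panel s c)
    (hl : B.dist c' d = B.dist c d + 1) : B.δ c' d = M.simple s * B.δ c d := by
  refine (B.δ_of_mem_panel h d).resolve_right fun h' => ?_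
  rw [dist, dist, h'] at hl
  omega

theorem eq_of_mem_panel_of_dist {s : S} {c p q d : C} (hp : c ∈ B.panel s p)
    (hq : c ∈ B.panel s q) (hlp : B.dist c d = B.dist p d + 1) (hlq : B.dist c d = B.dist q d + 1) :
    p = q := by
  rw [← B.δ_eq_one_iff]
  refine (B.mem_panel_trans hp (B.mem_panel_symm hq)).resolve_right fun h => ?_
  have h1 : M.simple s * B.δ q d = B.δ c d := (B.δ_of_mem_panel_of_dist hq hlq).symm
  have h2 := B.δ_adj_of_length s q p d h (by
    rw [h1]
    exact hlq)
  rw [h1] at h2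
  rw [dist, dist, ← h2] at hlp
  omega

/-- The gate property: each panel has one chamber nearest to `d`, and all its other chambers are
exactly one step farther. -/
theorem exists_proj (s : S) (c d : C) : ∃ p, c ∈ B.panel s p ∧
    ∀ c' ∈ B.panel s p, c' = p ∨ B.dist c' d = B.dist p d + 1 := by
  obtain ⟨p, hp, hl⟩ : ∃ p, c ∈ B.panel s p ∧ M.len (M.simple s * B.δ p d) = B.dist p d + 1 := by
    rcases M.len_simple_mul s (B.δ c d) with h | h
    · exact ⟨c, B.mem_panel_self s c, h⟩
    · obtain ⟨p, hp, hd⟩ := B.exists_adj s c d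
      refine ⟨p, Or.inr hp, ?_⟩
      rw [dist, hd, M.simple_mul_cancel]
      exact h.symm
  refine ⟨p, hp, fun c' hc' => ?_⟩
  rcases hc' with h | h
  · exact Or.inl ((B.δ_eq_one_iff p c').1 h).symm
  · right
    rw [dist, B.δ_adj_of_length s p c' d (B.δ_symm_simple h) hl]
    exact hl

theorem dist_eq_zero_iff {c d : C} : B.dist c d = 0 ↔ c = d := by
  rw [← B.δ_eq_one_iff]
  exact M.len_eq_zero_iff

theorem exists_panel_dist_lt {c d : C} (h : c ≠ d) :
    ∃ s p, c ∈ B.panel s p ∧ B.dist c d = B.dist p d + 1 := by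
  rw [Ne, ← B.δ_eq_one_iff] at h
  obtain ⟨s, hs⟩ := M.exists_len_simple_mul_lt h
  obtain ⟨p, hp, hd⟩ := B.exists_adj s c d
  refine ⟨s, p, Or.inr hp, ?_⟩
  rw [dist, dist, hd]
  exact hs.symm

/-- A permutation of the chambers that preserves adjacency is an automorphism. -/
theorem mem_Aut_of_adj (g : Equiv.Perm C)
    (h : ∀ s c d, B.δ c d = M.simple s → B.δ (g c) (g d) = M.simple s) : g ∈ B.Aut := by
  intro c d
  induction hn : B.dist c d using Nat.strong_induction_on generalizing c with
  | _ n ih =>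
    by_cases hcd : B.δ c d = 1
    · rw [hcd, δ_eq_one_iff, (B.δ_eq_one_iff c d).1 hcd]
    obtain ⟨s, hs⟩ := M.exists_len_simple_mul_lt hcd
    obtain ⟨p, hp, hd⟩ := B.exists_adj s c d
    have hpd : B.dist p d + 1 = n := by
      rw [← hn, dist, hd]
      exact hs
    have key := ih (B.dist p d) (by omega) p rfl
    rw [B.δ_adj_of_length s (g p) (g c) (g d) (B.δ_symm_simple (h s p c hp)), key, hd,
      M.simple_mul_cancel]
    rw [key, hd, M.simple_mul_cancel]
    exact hs.symm

theorem smul_mem_panel (g : B.Aut) {s : S} {c d : C} (h : d ∈ B.panel s c) :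
    g • d ∈ B.panel s (g • c) := by
  change B.δ ((g : Equiv.Perm C) c) ((g : Equiv.Perm C) d) = 1 ∨
    B.δ ((g : Equiv.Perm C) c) ((g : Equiv.Perm C) d) = M.simple s
  rw [g.2 c d]
  exact h

end Building

/-! ### Moves to a chamber of given colour -/

namespace LegalColouring

variable {S : Type u} {M : CoxeterMatrix S} {C : Type v} {B : Building M C} {Ω : S → Type w}
  (lam : LegalColouring B Ω)

/-- The chamber of colour `a` in the `s`-panel of `c`. -/
def move (s : S) (a : Ω s) (c : C) : C := (lam.panelEquiv s c).symm a

theorem move_mem (s : S) (a : Ω s) (c : C) : lam.move s a c ∈ B.panel s c :=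
  ((lam.panelEquiv s c).symm a).2

theorem colour_move (s : S) (a : Ω s) (c : C) : lam.colour (lam.move s a c) s = a :=
  (lam.panelEquiv s c).apply_symm_apply a

theorem colour_move_of_ne {s t : S} (h : t ≠ s) (a : Ω s) (c : C) :
    lam.colour (lam.move s a c) t = lam.colour c t :=
  lam.const t s h.symm c _ (lam.move_mem s a c)

theorem eq_move {s : S} {c d : C} (h : d ∈ B.panel s c) : d = lam.move s (lam.colour d s) c :=
  (lam.bijOn s c).injOn h (lam.move_mem s _ c) (lam.colour_move s _ c).symm

theorem move_colour (s : S) (c : C) : lam.move s (lam.colour c s) c = c :=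
  (lam.eq_move (B.mem_panel_self s c)).symm

theorem move_of_mem_panel {s : S} {c d : C} (h : d ∈ B.panel s c) (a : Ω s) :
    lam.move s a d = lam.move s a c := by
  have := lam.eq_move (B.mem_panel_trans h (lam.move_mem s a d))
  rwa [colour_move] at this

theorem move_move (s : S) (a b : Ω s) (c : C) :
    lam.move s b (lam.move s a c) = lam.move s b c :=
  lam.move_of_mem_panel (lam.move_mem s a c) b

theorem move_induction {p : C → Prop} (c₀ : C) (base : p c₀)
    (step : ∀ s a c, p c → p (lam.move s a c)) (c : C) : p c := by
  induction hn : B.dist c c₀ using Nat.strong_induction_on generalizing c with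
  | _ n ih =>
    by_cases h : c = c₀
    · rwa [h]
    obtain ⟨s, q, hq, hl⟩ := B.exists_panel_dist_lt h
    rw [lam.eq_move hq]
    exact step _ _ _ (ih _ (by omega) q rfl)

theorem ext_of_move {X : Type*} {φ ψ : C → X} (m : ∀ s, Ω s → X → X) (c₀ : C)
    (h₀ : φ c₀ = ψ c₀) (hφ : ∀ s a c, φ (lam.move s a c) = m s a (φ c))
    (hψ : ∀ s a c, ψ (lam.move s a c) = m s a (ψ c)) : φ = ψ :=
  funext <| lam.move_induction c₀ h₀ fun s a c h => by rw [hφ, hψ, h]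

end LegalColouring

/-! ### Commuting moves and the universal property -/

namespace RightAngled

variable {S : Type u} {Γ : SimpleGraph S} {C : Type v} {B : Building (rightAngledMatrix Γ) C}
  {Ω : S → Type w} (lam : LegalColouring B Ω)

/-- If both moves are proper, the Weyl distance between the end points is `st = ts`. Reading it in
the other order gives a second path around the square, and the colours identify its corners. -/
theorem move_comm {s t : S} (h : Γ.Adj s t) (a : Ω s) (b : Ω t) (c : C) :
    lam.move s a (lam.move t b c) = lam.move t b (lam.move s a c) := by
  obtain ⟨d, hd⟩ : ∃ d, d = lam.move t b c := ⟨_, rfl⟩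
  obtain ⟨e, he⟩ : ∃ e, e = lam.move s a d := ⟨_, rfl⟩
  have hd' : d ∈ B.panel t c := hd ▸ lam.move_mem t b c
  have he' : e ∈ B.panel s d := he ▸ lam.move_mem s a d
  have hdb : lam.colour d t = b := by rw [hd, lam.colour_move]
  have hea : lam.colour e s = a := by rw [he, lam.colour_move]
  rw [← hd, ← he]
  rcases hd' with h1 | h1
  · have hcd := (B.δ_eq_one_iff _ _).1 h1
    have : lam.colour (lam.move s a c) t = b := by
      rw [lam.colour_move_of_ne h.ne', hcd, hdb]
    rw [← this, lam.move_colour, he, hcd]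
  rcases he' with h2 | h2
  · have hde := (B.δ_eq_one_iff _ _).1 h2
    have : lam.colour c s = a := by
      rw [← hea, ← hde, hd, lam.colour_move_of_ne h.ne]
    rw [← this, lam.move_colour, ← hde, hd]
  have hl : (rightAngledMatrix Γ).len
      ((rightAngledMatrix Γ).simple s * (rightAngledMatrix Γ).simple t) = 2 := by
    rcases (rightAngledMatrix Γ).len_simple_mul s ((rightAngledMatrix Γ).simple t) with h3 | h3
    · rw [h3, CoxeterMatrix.len_simple]
    · rw [CoxeterMatrix.len_simple, Nat.add_eq_right, CoxeterMatrix.len_eq_zero_iff,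
        mul_eq_one_iff_eq_inv, CoxeterMatrix.simple_inv] at h3
      exact absurd (simple_injective h3) h.ne
  have hec : B.δ e c = (rightAngledMatrix Γ).simple t * (rightAngledMatrix Γ).simple s := by
    rw [← simple_comm h, ← B.δ_symm_simple h1]
    apply B.δ_adj_of_length s d e c (B.δ_symm_simple h2)
    rw [B.δ_symm_simple h1]
    exact hl.trans (congrArg (· + 1) (CoxeterMatrix.len_simple _ t).symm)
  obtain ⟨f, hf, hfc⟩ := B.exists_adj t e c
  rw [hec, CoxeterMatrix.simple_mul_cancel] at hfc
  have hfs : lam.colour f s = a := by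
    rw [← hea]
    exact (lam.const s t h.ne' f e (Or.inr hf)).symm
  have hf' : f = lam.move s a c := by
    rw [← hfs]
    exact lam.eq_move (Or.inr (B.δ_symm_simple hfc))
  have het : lam.colour e t = b := by rw [he, lam.colour_move_of_ne h.ne', hdb]
  rw [← hf', ← het]
  exact lam.eq_move (Or.inr hf)

section Extension

variable {X : Type x} (m : ∀ s, Ω s → X → X) (c₀ : C) (x₀ : X)

/-- The end points of the galleries from `c₀` and from `x₀` with the same colours, where the one
from `c₀` is minimal. -/
inductive MinGallery : C → X → Prop
  | base : MinGallery c₀ x₀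
  | step (s : S) (a : Ω s) (c : C) (y : X) (h : MinGallery c y)
      (hl : B.dist (lam.move s a c) c₀ = B.dist c c₀ + 1) :
      MinGallery (lam.move s a c) (m s a y)

theorem MinGallery.exists (c : C) : ∃ y, MinGallery lam m c₀ x₀ c y := by
  induction hn : B.dist c c₀ using Nat.strong_induction_on generalizing c with
  | _ n ih =>
    by_cases h : c = c₀
    · rw [h]
      exact ⟨x₀, .base⟩
    obtain ⟨s, q, hq, hl⟩ := B.exists_panel_dist_lt h
    obtain ⟨y, hy⟩ := ih _ (by omega) q rfl
    have e := lam.eq_move hq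
    rw [e] at hl ⊢
    exact ⟨_, .step s _ q y hy hl⟩

theorem MinGallery.cases_move {c : C} {y : X} (h : MinGallery lam m c₀ x₀ c y) :
    (c = c₀ ∧ y = x₀) ∨ ∃ s p z, c ∈ B.panel s p ∧ B.dist c c₀ = B.dist p c₀ + 1 ∧
      MinGallery lam m c₀ x₀ p z ∧ y = m s (lam.colour c s) z := by
  cases h with
  | base => exact Or.inl ⟨rfl, rfl⟩
  | step s a c y h hl =>
    exact Or.inr ⟨s, c, y, lam.move_mem s a c, hl, h, by rw [lam.colour_move]⟩

theorem MinGallery.unique (hcomm : ∀ s t, Γ.Adj s t → ∀ a b y, m s a (m t b y) = m t b (m s a y))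
    {c : C} {y z : X} (hy : MinGallery lam m c₀ x₀ c y) (hz : MinGallery lam m c₀ x₀ c z) :
    y = z := by
  induction hn : B.dist c c₀ using Nat.strong_induction_on generalizing c y z with
  | _ n ih =>
    subst hn
    have h0 : B.dist c₀ c₀ = 0 := B.dist_eq_zero_iff.2 rfl
    rcases hy.cases_move with ⟨rfl, rfl⟩ | ⟨s, p, y', hp, hlp, hpy, rfl⟩ <;>
      rcases hz.cases_move with ⟨hc, rfl⟩ | ⟨t, q, z', hq, hlq, hqz, rfl⟩
    · rfl
    · omega
    · subst hc; omega
    rcases eq_or_ne s t with rfl | hst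
    · obtain rfl := B.eq_of_mem_panel_of_dist hp hq hlp hlq
      rw [ih _ (by omega) hpy hqz rfl]
    have dp := B.δ_of_mem_panel_of_dist hp hlp
    have dq := B.δ_of_mem_panel_of_dist hq hlq
    have dp' : (rightAngledMatrix Γ).simple s * B.δ c c₀ = B.δ p c₀ := by
      rw [dp, CoxeterMatrix.simple_mul_cancel]
    have dq' : (rightAngledMatrix Γ).simple t * B.δ c c₀ = B.δ q c₀ := by
      rw [dq, CoxeterMatrix.simple_mul_cancel]
    have hs : (rightAngledMatrix Γ).len ((rightAngledMatrix Γ).simple s * B.δ c c₀) <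
        (rightAngledMatrix Γ).len (B.δ c c₀) := by
      rw [dp']
      change B.dist p c₀ < B.dist c c₀
      omega
    have ht : (rightAngledMatrix Γ).len ((rightAngledMatrix Γ).simple t * B.δ c c₀) <
        (rightAngledMatrix Γ).len (B.δ c c₀) := by
      rw [dq']
      change B.dist q c₀ < B.dist c c₀
      omega
    have hadj := adj_of_descents hst hs ht
    -- The last letters `s` and `t` commute, so `t` is still a descent at `p`. This yields a chamber
    -- `e`, two steps closer to `c₀` than `c`, that completes the square `c`, `p`, `q`, `e`.
    have hts := len_simple_mul_lt_of_adj hadj ht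
    rw [dp'] at hts
    obtain ⟨e, he, hde⟩ := B.exists_adj t p c₀
    rw [← hde] at hts
    have hle : B.dist e c₀ < B.dist p c₀ := hts
    have hle' : B.dist p c₀ = B.dist e c₀ + 1 := by
      rcases (rightAngledMatrix Γ).len_simple_mul t (B.δ p c₀) with h | h
      · rw [← hde] at h
        change B.dist e c₀ = B.dist p c₀ + 1 at h
        omega
      · rw [← hde] at h
        exact h.symm
    have hpt : lam.colour p t = lam.colour c t := (lam.const t s hst p c hp).symm
    have hpe : p = lam.move t (lam.colour c t) e := by
      rw [← hpt]
      exact lam.eq_move (Or.inr he)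
    have hcp : c = lam.move s (lam.colour c s) p := lam.eq_move hp
    obtain ⟨q', hq'⟩ : ∃ q', q' = lam.move s (lam.colour c s) e := ⟨_, rfl⟩
    have hcq' : c = lam.move t (lam.colour c t) q' := by
      rw [hq', ← move_comm lam hadj, ← hpe]
      exact hcp
    have hq'c : c ∈ B.panel t q' := by
      have := lam.move_mem t (lam.colour c t) q'
      rwa [← hcq'] at this
    have hq'le : B.dist q' c₀ ≤ B.dist e c₀ + 1 :=
      B.dist_le_of_mem_panel (hq' ▸ lam.move_mem s _ e) c₀
    have hq'ge := B.dist_le_of_mem_panel hq'c c₀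
    -- Only one chamber of the `t`-panel of `c` is closer to `c₀`, so the fourth corner `q'` is `q`.
    -- Both galleries can now be compared with one through `e`.
    have hqq' : q = q' := B.eq_of_mem_panel_of_dist hq hq'c hlq (by omega)
    obtain ⟨y₁, hy₁⟩ := MinGallery.exists lam m c₀ x₀ e
    have hp1 : MinGallery lam m c₀ x₀ p (m t (lam.colour c t) y₁) := by
      have := MinGallery.step t (lam.colour c t) e y₁ hy₁ (by rw [← hpe]; exact hle')
      rwa [← hpe] at this
    have hq1 : MinGallery lam m c₀ x₀ q (m s (lam.colour c s) y₁) := by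
      have := MinGallery.step s (lam.colour c s) e y₁ hy₁ (by rw [← hq', ← hqq']; omega)
      rwa [← hq', ← hqq'] at this
    rw [ih _ (by omega) hpy hp1 rfl, ih _ (by omega) hqz hq1 rfl, hcomm s t hadj]

/-- The universal property of a right-angled building with a legal colouring: a system of maps
that satisfies the relations between the moves extends uniquely to an equivariant map. -/
theorem exists_equivariant (hcomm : ∀ s t, Γ.Adj s t → ∀ a b y, m s a (m t b y) = m t b (m s a y))
    (hidem : ∀ s a b y, m s b (m s a y) = m s b y) (K : C → X → Prop) (h₀ : K c₀ x₀)
    (hK : ∀ s a c y, K c y → K (lam.move s a c) (m s a y))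
    (hfix : ∀ s c y, K c y → m s (lam.colour c s) y = y) :
    ∃ φ : C → X, φ c₀ = x₀ ∧ (∀ s a c, φ (lam.move s a c) = m s a (φ c)) ∧ ∀ c, K c (φ c) := by
  choose φ hφ using MinGallery.exists lam m c₀ x₀
  have hφK : ∀ c y, MinGallery lam m c₀ x₀ c y → K c y := by
    intro c y h
    induction h with
    | base => exact h₀
    | step s a c y _ _ ih => exact hK s a c y ih
  have key : ∀ {c y}, MinGallery lam m c₀ x₀ c y → φ c = y := fun h =>
    MinGallery.unique lam m c₀ x₀ hcomm (hφ _) h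
  refine ⟨φ, key .base, fun s a c => ?_, fun c => hφK c _ (hφ c)⟩
  -- From the gate `p` of the panel every move either lengthens a minimal gallery or stays at `p`,
  -- where `hfix` applies. Other starting chambers reduce to `p` by `hidem`.
  obtain ⟨p, hp, hmin⟩ := B.exists_proj s c c₀
  have main : ∀ a, φ (lam.move s a p) = m s a (φ p) := by
    intro a
    rcases hmin _ (lam.move_mem s a p) with h | h
    · have : lam.colour p s = a := by
        rw [← h, lam.colour_move]
      rw [h, ← this, hfix s p _ (hφK p _ (hφ p))]
    · exact key (.step s a p _ (hφ p) h)
  rw [lam.move_of_mem_panel hp, main a]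
  conv_rhs => rw [lam.eq_move hp, main, hidem]

end Extension

end RightAngled

/-! ### Freeness of `F/F⁺` on classes of colours -/

section Orbits

variable {Ω : Type w} {F : Subgroup (Equiv.Perm Ω)}

theorem plusSetoid_iff {a b : Ω} :
    plusSetoid F a b ↔ ∃ n ∈ stabilizersSubgroup F Ω, (n : Equiv.Perm Ω) b = a := by
  change a ∈ MulAction.orbit _ b ↔ _
  constructor
  · rintro ⟨⟨n, hn⟩, rfl⟩
    exact ⟨n, hn, rfl⟩
  · rintro ⟨n, hn, rfl⟩
    exact ⟨⟨n, hn⟩, rfl⟩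

theorem mem_stabilizersSubgroup {G : Type u} [Group G] {X : Type v} [MulAction G X] {g : G} {a : X}
    (h : g • a = a) : g ∈ stabilizersSubgroup G X :=
  le_iSup (fun a : X => MulAction.stabilizer G a) a (MulAction.mem_stabilizer_iff.2 h)

theorem plusSetoid_apply {f : Equiv.Perm Ω} (hf : f ∈ F) {a b : Ω} (h : plusSetoid F a b) :
    plusSetoid F (f a) (f b) := by
  rw [plusSetoid_iff] at h ⊢
  obtain ⟨n, hn, rfl⟩ := h
  exact ⟨⟨f, hf⟩ * n * ⟨f, hf⟩⁻¹, (stabilizersSubgroup_normal F Ω).conj_mem n hn _, by simp⟩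

/-- The action of `F/F⁺` on the set of `F⁺`-orbits is free. -/
theorem plusSetoid_of_plusSetoid {f f' : Equiv.Perm Ω} (hf : f ∈ F) (hf' : f' ∈ F) {a : Ω}
    (h : plusSetoid F (f a) (f' a)) (b : Ω) : plusSetoid F (f b) (f' b) := by
  obtain ⟨n, hn, hna⟩ := plusSetoid_iff.1 h
  -- Chosen so that `f * e = n * f'`. It fixes `a`, hence lies in `F⁺`.
  let e : F := ⟨f, hf⟩⁻¹ * n * ⟨f', hf'⟩
  have he : e ∈ stabilizersSubgroup F Ω := by
    apply mem_stabilizersSubgroup (a := a)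
    change f⁻¹ ((n : Equiv.Perm Ω) (f' a)) = a
    rw [hna, Equiv.Perm.inv_eq_iff_eq]
  have h1 : plusSetoid F (f ((e : Equiv.Perm Ω) b)) (f' b) := by
    refine plusSetoid_iff.2 ⟨n, hn, ?_⟩
    change _ = f (f⁻¹ ((n : Equiv.Perm Ω) (f' b)))
    exact f.inv_eq_iff_eq.1 rfl
  exact (plusSetoid F).trans
    ((plusSetoid F).symm (plusSetoid_apply hf (plusSetoid_iff.2 ⟨e, he, rfl⟩))) h1

theorem mem_quotientPermGroup_iff {σ : Equiv.Perm (Quotient (plusSetoid F))} :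
    σ ∈ quotientPermGroup F ↔
      ∃ f ∈ F, ∀ a, σ (Quotient.mk (plusSetoid F) a) = Quotient.mk (plusSetoid F) (f a) := by
  constructor
  · rintro ⟨f, rfl⟩
    obtain ⟨f, rfl⟩ := QuotientGroup.mk_surjective f
    exact ⟨f, f.2, fun a => rfl⟩
  · rintro ⟨f, hf, h⟩
    refine ⟨QuotientGroup.mk ⟨f, hf⟩, ?_⟩
    ext y
    induction y using Quotient.inductionOn with
    | _ a => exact (h a).symm

theorem quotientPermGroup_free {σ τ : Equiv.Perm (Quotient (plusSetoid F))}
    (hσ : σ ∈ quotientPermGroup F) (hτ : τ ∈ quotientPermGroup F) {y : Quotient (plusSetoid F)}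
    (h : σ y = τ y) : σ = τ := by
  rw [mem_quotientPermGroup_iff] at hσ hτ
  obtain ⟨f, hf, hf'⟩ := hσ
  obtain ⟨g, hg, hg'⟩ := hτ
  induction y using Quotient.inductionOn with
  | _ a =>
    rw [hf', hg'] at h
    ext z
    induction z using Quotient.inductionOn with
    | _ b =>
      rw [hf', hg']
      exact Quotient.sound (plusSetoid_of_plusSetoid hf hg (Quotient.exact h) b)

end Orbits

/-! ### Local actions of elements of the universal group -/

namespace LegalColouring

variable {S : Type u} {M : CoxeterMatrix S} {C : Type v} {B : Building M C} {Ω : S → Type w}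
  (lam : LegalColouring B Ω)

theorem localAction_apply (g : B.Aut) (s : S) (c : C) (a : Ω s) :
    lam.localAction g s c a = lam.colour (g • lam.move s a c) s := rfl

theorem localAction_colour (g : B.Aut) (s : S) (c : C) :
    lam.localAction g s c (lam.colour c s) = lam.colour (g • c) s := by
  rw [localAction_apply, move_colour]

theorem smul_move (g : B.Aut) (s : S) (a : Ω s) (c : C) :
    g • lam.move s a c = lam.move s (lam.localAction g s c a) (g • c) :=
  lam.eq_move (B.smul_mem_panel g (lam.move_mem s a c))

/-- If the prescribed local groups act freely on classes of colours, then an element of the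
universal group has constant local actions, up to the equivalence relations. -/
theorem exists_colour_smul {F : ∀ s, Subgroup (Equiv.Perm (Ω s))} {r : ∀ s, Setoid (Ω s)}
    (hF : ∀ s, ∀ f ∈ F s, ∀ f' ∈ F s, ∀ a, r s (f a) (f' a) → ∀ b, r s (f b) (f' b))
    {g : B.Aut} (hg : g ∈ lam.universalGroup F) (s : S) :
    ∃ f ∈ F s, ∀ c, r s (lam.colour (g • c) s) (f (lam.colour c s)) := by
  obtain ⟨c₀⟩ := B.nonempty
  refine ⟨lam.localAction g s c₀, hg s c₀, fun c => ?_⟩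
  refine lam.move_induction (p := fun c => r s (lam.colour (g • c) s)
    (lam.localAction g s c₀ (lam.colour c s))) c₀ ?_ (fun t a c ih => ?_) c
  · rw [localAction_colour]
  · rcases eq_or_ne s t with rfl | h
    · rw [lam.smul_move, colour_move, colour_move]
      rw [← localAction_colour] at ih
      -- The local actions at the panels of `c` and `c₀` agree up to `r` at the colour of `c`, hence
      -- by freeness at every colour.
      exact hF s _ (hg s c) _ (hg s c₀) _ ih a
    · rwa [lam.smul_move, lam.colour_move_of_ne h, lam.colour_move_of_ne h]

end LegalColouring

/-! ### Automorphisms with constant local actions -/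

namespace RightAngled

variable {S : Type u} {Γ : SimpleGraph S} {C : Type v} {B : Building (rightAngledMatrix Γ) C}
  {Ω : S → Type w} (lam : LegalColouring B Ω)

theorem exists_twisted_map (f : ∀ s, Equiv.Perm (Ω s)) {c₀ d₀ : C}
    (h : ∀ s, lam.colour d₀ s = f s (lam.colour c₀ s)) :
    ∃ φ : C → C, φ c₀ = d₀ ∧ ∀ s a c, φ (lam.move s a c) = lam.move s (f s a) (φ c) := by
  classical
  obtain ⟨φ, h₀, hm, -⟩ := exists_equivariant lam (fun s a => lam.move s (f s a)) c₀ d₀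
    (fun s t hst a b y => move_comm lam hst _ _ _) (fun s a b y => lam.move_move s _ _ y)
    (fun c d => ∀ s, lam.colour d s = f s (lam.colour c s)) h
    (fun s a c y hcy t => by
      rcases eq_or_ne t s with rfl | hts
      · rw [lam.colour_move, lam.colour_move]
      · rw [lam.colour_move_of_ne hts, lam.colour_move_of_ne hts, hcy])
    (fun s c y hcy => by
      rw [← hcy, lam.move_colour])
  exact ⟨φ, h₀, hm⟩

/-- An automorphism with prescribed constant local actions, and prescribed value at a chamber. -/
theorem exists_twisted_aut (f : ∀ s, Equiv.Perm (Ω s)) {c₀ d₀ : C}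
    (h : ∀ s, lam.colour d₀ s = f s (lam.colour c₀ s)) :
    ∃ g : B.Aut, g • c₀ = d₀ ∧ (∀ s c, lam.localAction g s c = f s) ∧
      ∀ s a c, g • lam.move s a c = lam.move s (f s a) (g • c) := by
  obtain ⟨φ, h₀, hm⟩ := exists_twisted_map lam f h
  -- The inverse comes from the inverse twist: both composites commute with all moves and fix a
  -- chamber, so they are the identity.
  obtain ⟨ψ, h₀', hm'⟩ := exists_twisted_map lam (fun s => (f s)⁻¹) (c₀ := d₀) (d₀ := c₀)
    (fun s => by rw [h, Equiv.Perm.eq_inv_iff_eq])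
  have h1 : ψ ∘ φ = id := lam.ext_of_move (fun s a => lam.move s a) c₀ (by simp [h₀, h₀'])
    (fun s a c => by
      rw [Function.comp_apply, hm, hm']
      congr 1
      rw [Equiv.Perm.inv_eq_iff_eq]) fun _ _ _ => rfl
  have h2 : φ ∘ ψ = id := lam.ext_of_move (fun s a => lam.move s a) d₀ (by simp [h₀, h₀'])
    (fun s a c => by
      rw [Function.comp_apply, hm', hm]
      congr 1
      exact ((f s).inv_eq_iff_eq.1 rfl).symm) fun _ _ _ => rfl
  let g : Equiv.Perm C := ⟨φ, ψ, congrFun h1, congrFun h2⟩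
  have hg : g ∈ B.Aut := B.mem_Aut_of_adj g fun s c d hcd => by
    have hd : d = lam.move s (lam.colour d s) c := lam.eq_move (Or.inr hcd)
    have hgd : g d = lam.move s (f s (lam.colour d s)) (g c) := by
      conv_lhs => rw [hd]
      exact hm _ _ _
    refine (hgd ▸ lam.move_mem s _ _ : g d ∈ B.panel s (g c)).resolve_left fun h => ?_
    rw [B.δ_eq_one_iff, g.injective.eq_iff] at h
    rw [h, B.δ_self] at hcd
    exact CoxeterMatrix.simple_ne_one _ _ hcd.symm
  have hgm : ∀ s a c, (⟨g, hg⟩ : B.Aut) • lam.move s a c =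
      lam.move s (f s a) ((⟨g, hg⟩ : B.Aut) • c) := hm
  refine ⟨⟨g, hg⟩, h₀, fun s c => ?_, hgm⟩
  ext a
  rw [lam.localAction_apply, hgm, lam.colour_move]

end RightAngled

namespace Building

variable {S : Type u} {M : CoxeterMatrix S} {C : Type v} (B : Building M C)

theorem eq_or_exists_mem_panel {c d : C} (h : B.dist c d ≤ 1) : c = d ∨ ∃ s, d ∈ B.panel s c := by
  rcases Nat.le_one_iff_eq_zero_or_eq_one.1 h with h | h
  · exact Or.inl (B.dist_eq_zero_iff.1 h)
  · obtain ⟨s, hs⟩ := M.len_eq_one_iff.1 h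
    exact Or.inr ⟨s, Or.inr hs⟩

end Building

/-- One move per generator corrects that colour and leaves the others alone; finiteness of `S` makes
this terminate. -/
theorem LegalColouring.exists_colour_eq {S : Type u} [Finite S] {M : CoxeterMatrix S} {C : Type v}
    {B : Building M C} {Ω : S → Type w} (lam : LegalColouring B Ω) (κ : ∀ s, Ω s) :
    ∃ c, ∀ s, lam.colour c s = κ s := by
  classical
  have := Fintype.ofFinite S
  suffices h : ∀ T : Finset S, ∃ c, ∀ s ∈ T, lam.colour c s = κ s by
    obtain ⟨c, hc⟩ := h Finset.univ
    exact ⟨c, fun s => hc s (Finset.mem_univ s)⟩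
  intro T
  induction T using Finset.induction_on with
  | empty => exact ⟨B.nonempty.some, by simp⟩
  | insert t T _ ih =>
    obtain ⟨c, hc⟩ := ih
    refine ⟨lam.move t (κ t) c, fun s hs => ?_⟩
    rcases eq_or_ne s t with rfl | hst
    · rw [lam.colour_move]
    · rw [lam.colour_move_of_ne hst, hc s (Finset.mem_of_mem_insert_of_ne hs hst)]

/-! ### Implosions as equivariant maps -/

section Implosion

variable {S : Type u} {Γ : SimpleGraph S} {C : Type v} {C' : Type x} {Ω : S → Type w}
  {B : Building (rightAngledMatrix Γ) C} {lam : LegalColouring B Ω} {r : ∀ s, Setoid (Ω s)}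
  {B' : Building (implodedMatrix Γ r) C'} {lam' : LegalColouring B' (ImplodedColours r)}

open Classical in
/-- The move of the imploded building induced by an element of the colour set `Ω s`: it is trivial
if there is only one class of `s`-colours. -/
def implodedMove (lam' : LegalColouring B' (ImplodedColours r)) (s : S) (a : Ω s) (c : C') : C' :=
  if h : s ∈ essentialTypes r then lam'.move ⟨s, h⟩ (Quotient.mk (r s) a) c else c

theorem implodedMove_of_mem {s : S} (h : s ∈ essentialTypes r) (a : Ω s) (c : C') :
    implodedMove lam' s a c = lam'.move ⟨s, h⟩ (Quotient.mk (r s) a) c := dif_pos h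

theorem implodedMove_of_notMem {s : S} (h : s ∉ essentialTypes r) (a : Ω s) (c : C') :
    implodedMove lam' s a c = c := dif_neg h

theorem SameColours.move {c : C} {c' : C'} (h : SameColours lam lam' c c') (s : S) (a : Ω s) :
    SameColours lam lam' (lam.move s a c) (implodedMove lam' s a c') := by
  intro t
  by_cases hs : s ∈ essentialTypes r
  · rw [implodedMove_of_mem hs]
    rcases eq_or_ne t ⟨s, hs⟩ with rfl | ht
    · rw [lam'.colour_move, lam.colour_move]
    · rw [lam'.colour_move_of_ne ht, lam.colour_move_of_ne fun h => ht (Subtype.ext h), h t]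
  · rw [implodedMove_of_notMem hs, lam.colour_move_of_ne (by rintro rfl; exact hs t.2), h t]

theorem SameColours.implodedMove_colour {c : C} {c' : C'} (h : SameColours lam lam' c c') (s : S) :
    implodedMove lam' s (lam.colour c s) c' = c' := by
  by_cases hs : s ∈ essentialTypes r
  · rw [implodedMove_of_mem hs, ← h ⟨s, hs⟩, lam'.move_colour]
  · rw [implodedMove_of_notMem hs]

/-- Metric and colour conditions force equivariance. An `s`-move has image within distance one of `τ
c`; a step of another type would change a colour class that the move preserves, and inside the
`s`-panel the colour determines the chamber. -/
theorem IsImplosion.map_move {τ : C → C'} (hτ : IsImplosion lam lam' τ) (s : S) (a : Ω s) (c : C) :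
    τ (lam.move s a c) = implodedMove lam' s a (τ c) := by
  have hcol := hτ.colour (lam.move s a c)
  obtain ⟨e, he⟩ : ∃ e, e = τ (lam.move s a c) := ⟨_, rfl⟩
  rw [← he] at hcol ⊢
  have key : e = τ c ∨ ∃ h : s ∈ essentialTypes r, e ∈ B'.panel ⟨s, h⟩ (τ c) := by
    have hd : B'.dist e (τ c) ≤ 1 := by
      refine he ▸ (hτ.nonexpansive _ _).trans ?_
      refine (B.dist_le_of_mem_panel (lam.move_mem s a c) c).trans ?_
      rw [B.dist_eq_zero_iff.2 rfl]
    rcases B'.eq_or_exists_mem_panel hd with h | ⟨t, ht⟩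
    · exact Or.inl h
    by_cases hts : s = t
    · subst hts
      exact Or.inr ⟨t.2, B'.mem_panel_symm ht⟩
    · left
      have h1 := lam'.eq_move (B'.mem_panel_symm ht)
      rwa [hcol t, lam.colour_move_of_ne (Ne.symm hts), ← hτ.colour c t, lam'.move_colour] at h1
  rcases key with h | ⟨hs, h⟩
  · by_cases hs : s ∈ essentialTypes r
    · have := hcol ⟨s, hs⟩
      rw [lam.colour_move] at this
      rw [implodedMove_of_mem hs, ← this, ← h, lam'.move_colour]
    · rw [implodedMove_of_notMem hs, h]
  · have := hcol ⟨s, hs⟩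
    rw [lam.colour_move] at this
    rw [implodedMove_of_mem hs, ← this]
    exact lam'.eq_move h

/-- Each step of a gallery maps to a step or is collapsed, so distances do not grow. Every move of
`B'` lifts by choosing a representative colour, so the map is onto. -/
theorem isImplosion_of_map_move {τ : C → C'}
    (hm : ∀ s a c, τ (lam.move s a c) = implodedMove lam' s a (τ c))
    (hc : ∀ c, SameColours lam lam' c (τ c)) : IsImplosion lam lam' τ where
  colour := hc
  surjective c' := by
    obtain ⟨c₀⟩ := B.nonempty
    refine lam'.move_induction (p := fun c' => ∃ c, τ c = c') (τ c₀) ⟨c₀, rfl⟩ ?_ c'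
    rintro ⟨s, hs⟩ y _ ⟨c, rfl⟩
    induction y using Quotient.inductionOn with
    | _ a => exact ⟨lam.move s a c, by rw [hm, implodedMove_of_mem hs]⟩
  nonexpansive c d := by
    induction hn : B.dist c d generalizing c with
    | zero => rw [B.dist_eq_zero_iff.1 hn, B'.dist_eq_zero_iff.2 rfl]
    | succ n ih =>
      obtain ⟨s, p, hp, hl⟩ := B.exists_panel_dist_lt (c := c) (d := d) (by
        rintro rfl
        rw [B.dist_eq_zero_iff.2 rfl] at hn
        omega)
      have h := ih p (by omega)
      rw [lam.eq_move hp, hm]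
      by_cases hs : s ∈ essentialTypes r
      · rw [implodedMove_of_mem hs]
        exact (B'.dist_le_of_mem_panel (lam'.move_mem _ _ _) _).trans (by omega)
      · rw [implodedMove_of_notMem hs]
        omega

theorem implodedMove_comm {s t : S} (h : Γ.Adj s t) (a : Ω s) (b : Ω t) (c : C') :
    implodedMove lam' s a (implodedMove lam' t b c) =
      implodedMove lam' t b (implodedMove lam' s a c) := by
  by_cases hs : s ∈ essentialTypes r
  · by_cases ht : t ∈ essentialTypes r
    · simp only [implodedMove_of_mem hs, implodedMove_of_mem ht]
      exact RightAngled.move_comm lam' (s := ⟨s, hs⟩) (t := ⟨t, ht⟩) h _ _ c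
    · simp only [implodedMove_of_notMem ht]
  · simp only [implodedMove_of_notMem hs]

theorem implodedMove_implodedMove (s : S) (a b : Ω s) (c : C') :
    implodedMove lam' s b (implodedMove lam' s a c) = implodedMove lam' s b c := by
  by_cases hs : s ∈ essentialTypes r
  · simp only [implodedMove_of_mem hs, lam'.move_move]
  · simp only [implodedMove_of_notMem hs]

theorem existsUnique_isImplosion {c₀ : C} {c₀' : C'} (h : SameColours lam lam' c₀ c₀') :
    ∃! τ : C → C', IsImplosion lam lam' τ ∧ τ c₀ = c₀' := by
  obtain ⟨τ, h₀, hm, hK⟩ := RightAngled.exists_equivariant lam (implodedMove lam') c₀ c₀'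
    (fun _ _ hst a b c => implodedMove_comm hst a b c) implodedMove_implodedMove
    (SameColours lam lam') h (fun s a c y hy => hy.move s a)
    (fun s c y hy => hy.implodedMove_colour s)
  refine ⟨τ, ⟨isImplosion_of_map_move hm hK, h₀⟩, ?_⟩
  rintro τ' ⟨hτ', h₀'⟩
  exact lam.ext_of_move (implodedMove lam') c₀ (h₀'.trans h₀.symm) hτ'.map_move hm

/-- Automorphisms that are intertwined by an implosion at a chamber, and whose local actions are
intertwined, are intertwined everywhere. -/
theorem IsImplosion.smul_eq {τ : C → C'} (hτ : IsImplosion lam lam' τ) {g : B.Aut} {h : B'.Aut}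
    {c₀ : C} (h₀ : h • τ c₀ = τ (g • c₀))
    (hloc : ∀ (s : essentialTypes r) a c, lam'.localAction h s (τ c) (Quotient.mk (r s) a) =
      Quotient.mk (r s) (lam.localAction g s c a)) (c : C) : h • τ c = τ (g • c) := by
  refine lam.move_induction (p := fun c => h • τ c = τ (g • c)) c₀ h₀ (fun s a c ih => ?_) c
  rw [hτ.map_move, lam.smul_move, hτ.map_move]
  by_cases hs : s ∈ essentialTypes r
  · rw [implodedMove_of_mem hs, implodedMove_of_mem hs, lam'.smul_move, hloc ⟨s, hs⟩, ih]
  · rw [implodedMove_of_notMem hs, implodedMove_of_notMem hs, ih]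

end Implosion

theorem stabilizersSubgroup_induction {G : Type u} [Group G] {X : Type v} [MulAction G X]
    {motive : G → Prop} {g : G} (hg : g ∈ stabilizersSubgroup G X)
    (mem : ∀ (a : X) (g : G), g • a = a → motive g) (one : motive 1)
    (mul : ∀ g h, motive g → motive h → motive (g * h)) : motive g :=
  Subgroup.iSup_induction (C := motive) _ hg (fun a g h => mem a g (MulAction.mem_stabilizer_iff.1 h)) one mul

/-! ### Colours under the group generated by chamber stabilizers -/

namespace LegalColouring

variable {S : Type u} {M : CoxeterMatrix S} {C : Type v} {B : Building M C} {Ω : S → Type w}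
  (lam : LegalColouring B Ω) {F : ∀ s, Subgroup (Equiv.Perm (Ω s))}

theorem exists_colour_smul_plusSetoid {g : B.Aut} (hg : g ∈ lam.universalGroup F) (s : S) :
    ∃ f ∈ F s, ∀ c, plusSetoid (F s) (lam.colour (g • c) s) (f (lam.colour c s)) :=
  lam.exists_colour_smul
    (fun s _ hf _ hf' _ h => plusSetoid_of_plusSetoid (F := F s) hf hf' h) hg s

/-- An element fixing a chamber fixes the class of that chamber's colour, so by freeness it acts
trivially on all classes. The property passes to products. -/
theorem colour_smul_of_mem_stabilizersSubgroup {g : lam.universalGroup F}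
    (hg : g ∈ stabilizersSubgroup (lam.universalGroup F) C) (s : S) (c : C) :
    plusSetoid (F s) (lam.colour (g • c) s) (lam.colour c s) := by
  revert c
  refine stabilizersSubgroup_induction (motive := fun g => ∀ c,
    plusSetoid (F s) (lam.colour (g • c) s) (lam.colour c s)) hg ?_ ?_ ?_
  · intro c₁ g hg c
    obtain ⟨f, hf, h⟩ := lam.exists_colour_smul_plusSetoid g.2 s
    have h1 := h c₁
    rw [← Subgroup.smul_def, hg] at h1
    have h2 := plusSetoid_of_plusSetoid (F := F s) (one_mem _) hf (a := lam.colour c₁ s) h1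
      (lam.colour c s)
    exact (plusSetoid (F s)).trans (h c) ((plusSetoid (F s)).symm h2)
  · intro c
    rw [one_smul]
  · intro g g' ih ih' c
    rw [mul_smul]
    exact (plusSetoid (F s)).trans (ih _) (ih' _)

theorem localAction_of_mem_stabilizersSubgroup {g : lam.universalGroup F}
    (hg : g ∈ stabilizersSubgroup (lam.universalGroup F) C) (s : S) (c : C) (a : Ω s) :
    plusSetoid (F s) (lam.localAction g s c a) a := by
  have := lam.colour_smul_of_mem_stabilizersSubgroup hg s (lam.move s a c)
  rwa [lam.colour_move] at this

end LegalColouring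

/-! ### Fibres of an implosion and orbits of chambers -/

section Orbits

variable {S : Type u} {Γ : SimpleGraph S} {C : Type v} {Ω : S → Type w}
  {B : Building (rightAngledMatrix Γ) C} (lam : LegalColouring B Ω)
  (F : ∀ s, Subgroup (Equiv.Perm (Ω s)))

/-- The orbit of a chamber under the subgroup generated by all chamber stabilizers. -/
def chamberOrbit (c : C) :
    MulAction.orbitRel.Quotient (stabilizersSubgroup (lam.universalGroup F) C) C :=
  Quotient.mk _ c

variable {lam F}

theorem chamberOrbit_eq_iff {c d : C} : chamberOrbit lam F c = chamberOrbit lam F d ↔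
    ∃ g ∈ stabilizersSubgroup (lam.universalGroup F) C, g • d = c := by
  refine Quotient.eq.trans ?_
  change c ∈ MulAction.orbit _ d ↔ _
  constructor
  · rintro ⟨⟨n, hn⟩, rfl⟩
    exact ⟨n, hn, rfl⟩
  · rintro ⟨n, hn, rfl⟩
    exact ⟨⟨n, hn⟩, rfl⟩

/-- It suffices to treat a generator `n` of `(F s)⁺` fixing a colour `e`. The automorphism with
local action `n` in type `s`, trivial in other types and fixing the `e`-chamber of the panel,
carries the chamber of colour `b` to that of colour `n b`. -/
theorem chamberOrbit_move_eq {s : S} {a b : Ω s} (h : plusSetoid (F s) a b) (c : C) :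
    chamberOrbit lam F (lam.move s a c) = chamberOrbit lam F (lam.move s b c) := by
  classical
  obtain ⟨n, hn, rfl⟩ := plusSetoid_iff.1 h
  clear h
  refine stabilizersSubgroup_induction (motive := fun n : F s => ∀ b,
    chamberOrbit lam F (lam.move s ((n : Equiv.Perm (Ω s)) b) c) =
      chamberOrbit lam F (lam.move s b c)) hn ?_ ?_ ?_ b
  · intro e n hn b
    have hne : (n : Equiv.Perm (Ω s)) e = e := hn
    let f : ∀ t, Equiv.Perm (Ω t) := Function.update 1 s n
    have hf : ∀ t, f t ∈ F t := by
      intro t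
      rcases eq_or_ne t s with rfl | ht
      · simp [f]
      · simp [f, ht]
    obtain ⟨g, hg, hloc, hm⟩ := RightAngled.exists_twisted_aut lam f
      (c₀ := lam.move s e c) (d₀ := lam.move s e c) (fun t => by
        rcases eq_or_ne t s with rfl | ht
        · simp [f, lam.colour_move, hne]
        · simp [f, ht])
    rw [chamberOrbit_eq_iff]
    refine ⟨⟨g, fun t c => by rw [hloc]; exact hf t⟩, mem_stabilizersSubgroup hg, ?_⟩
    change g • lam.move s b c = _
    rw [← lam.move_move s e b c, hm, hg, lam.move_move]
    simp [f]
  · exact fun _ => rfl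
  · exact fun n n' ih ih' b => (ih _).trans (ih' b)

theorem chamberOrbit_move_congr {c d : C} (h : chamberOrbit lam F c = chamberOrbit lam F d) (s : S)
    (a : Ω s) : chamberOrbit lam F (lam.move s a c) = chamberOrbit lam F (lam.move s a d) := by
  obtain ⟨g, hg, rfl⟩ := chamberOrbit_eq_iff.1 h
  refine (chamberOrbit_move_eq ((plusSetoid (F s)).symm
    (lam.localAction_of_mem_stabilizersSubgroup hg s d a)) _).trans ?_
  exact chamberOrbit_eq_iff.2 ⟨g, hg, lam.smul_move _ s a d⟩

/-- Moves descend to orbits of chambers and there depend only on the class of the colour, so the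
orbit set carries the operations needed to receive a map from `B'`. -/
theorem exists_orbitMove (s : S) (y : Quotient (plusSetoid (F s))) :
    ∃ m : MulAction.orbitRel.Quotient (stabilizersSubgroup (lam.universalGroup F) C) C →
        MulAction.orbitRel.Quotient (stabilizersSubgroup (lam.universalGroup F) C) C,
      ∀ a c, Quotient.mk (plusSetoid (F s)) a = y →
        m (chamberOrbit lam F c) = chamberOrbit lam F (lam.move s a c) := by
  induction y using Quotient.inductionOn with
  | _ b =>
    refine ⟨Quotient.lift (fun c => chamberOrbit lam F (lam.move s b c)) fun c d h =>
      chamberOrbit_move_congr (Quotient.sound h) s b, fun a c h => ?_⟩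
    exact (chamberOrbit_move_eq (Quotient.exact h) c).symm

variable {C' : Type x} {B' : Building (implodedMatrix Γ (fun s => plusSetoid (F s))) C'}
  {lam' : LegalColouring B' (ImplodedColours (fun s => plusSetoid (F s)))}

/-- The fibres of an implosion are orbits of the subgroup generated by all chamber stabilizers. -/
theorem IsImplosion.chamberOrbit_eq {τ : C → C'} (hτ : IsImplosion lam lam' τ) {c d : C}
    (h : τ c = τ d) : chamberOrbit lam F c = chamberOrbit lam F d := by
  choose m hm using fun s : essentialTypes (fun s => plusSetoid (F s)) =>
    exists_orbitMove (lam := lam) (F := F) s.1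
  have hm' : ∀ s a c, m s (Quotient.mk (plusSetoid (F s)) a) (chamberOrbit lam F c) =
      chamberOrbit lam F (lam.move s a c) := fun s a c => hm s _ a c rfl
  -- The universal property of `B'` yields `θ` with `θ ∘ τ` the orbit projection, so chambers with
  -- equal image under `τ` share an orbit.
  obtain ⟨θ, h₀, hθ, -⟩ := RightAngled.exists_equivariant lam' m (τ c) (chamberOrbit lam F c)
    (fun s t hst a b y => by
      induction y using Quotient.inductionOn with
      | _ c =>
        induction a using Quotient.inductionOn with
        | _ a =>
          induction b using Quotient.inductionOn with
          | _ b =>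
            change m s _ (m t _ (chamberOrbit lam F c)) = m t _ (m s _ (chamberOrbit lam F c))
            rw [hm', hm', hm', hm']
            exact congrArg _ (RightAngled.move_comm lam (s := s.1) (t := t.1) hst a b c))
    (fun s a b y => by
      induction y using Quotient.inductionOn with
      | _ c =>
        induction a using Quotient.inductionOn with
        | _ a =>
          induction b using Quotient.inductionOn with
          | _ b =>
            change m s _ (m s _ (chamberOrbit lam F c)) = m s _ (chamberOrbit lam F c)
            rw [hm', hm', hm', lam.move_move])
    (fun c' y => ∃ c, chamberOrbit lam F c = y ∧ SameColours lam lam' c c')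
    ⟨c, rfl, hτ.colour c⟩
    (by
      rintro s a c' _ ⟨c, rfl, hc⟩
      induction a using Quotient.inductionOn with
      | _ a =>
        refine ⟨lam.move s a c, (hm' s a c).symm, ?_⟩
        have := hc.move s a
        rwa [implodedMove_of_mem s.2] at this)
    (by
      rintro s c' _ ⟨c, rfl, hc⟩
      rw [hc s, hm', lam.move_colour])
  have key : ∀ e, θ (τ e) = chamberOrbit lam F e := by
    refine lam.move_induction c h₀ fun s a e ih => ?_
    rw [hτ.map_move]
    by_cases hs : s ∈ essentialTypes (fun s => plusSetoid (F s))
    · rw [implodedMove_of_mem hs, hθ, ih]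
      exact hm' ⟨s, hs⟩ a e
    · rw [implodedMove_of_notMem hs, ih]
      -- With a single class of `s`-colours, an `s`-move does not leave the orbit.
      have hsub : Subsingleton (Quotient (plusSetoid (F s))) := not_nontrivial_iff_subsingleton.1 hs
      conv_lhs => rw [← lam.move_colour s e]
      exact chamberOrbit_move_eq (Quotient.exact (hsub.elim _ _)) e
  rw [← key c, h, key d]

end Orbits

/-! ### The induced epimorphism and its kernel -/

section UniversalGroup

variable {S : Type u} {Γ : SimpleGraph S} {C : Type v} {Ω : S → Type w}
  {B : Building (rightAngledMatrix Γ) C} {lam : LegalColouring B Ω}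
  {F : ∀ s, Subgroup (Equiv.Perm (Ω s))}
  {C' : Type x} {B' : Building (implodedMatrix Γ (fun s => plusSetoid (F s))) C'}
  {lam' : LegalColouring B' (ImplodedColours (fun s => plusSetoid (F s)))}
  {τ : C → C'}

/-- Modulo `(F s)⁺` the local action of `g` is the same at all `s`-panels, so the image is an
automorphism of `B'` with those constant local actions. -/
theorem IsImplosion.exists_image (hτ : IsImplosion lam lam' τ)
    (g : lam.universalGroup F) :
    ∃ h : lam'.universalGroup (fun s => quotientPermGroup (F s)), ∀ c, h • τ c = τ (g • c) := by
  obtain ⟨c₀⟩ := B.nonempty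
  choose f hf hfc using lam.exists_colour_smul_plusSetoid g.2
  have hσ : ∀ s : essentialTypes (fun s => plusSetoid (F s)),
      ∃ σ ∈ quotientPermGroup (F s), ∀ a, σ (Quotient.mk (plusSetoid (F s)) a) =
        Quotient.mk (plusSetoid (F s)) (f s a) := fun s =>
    ⟨quotientPermHom (F s) (QuotientGroup.mk ⟨f s, hf s⟩), ⟨_, rfl⟩, fun _ => rfl⟩
  choose σ hσ hσf using hσ
  obtain ⟨h, h₀, hloc, -⟩ := RightAngled.exists_twisted_aut lam' σ (c₀ := τ c₀) (d₀ := τ (g • c₀))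
    (fun s => by
      rw [hτ.colour, hτ.colour, hσf]
      exact Quotient.sound (hfc s c₀))
  refine ⟨⟨h, fun s c => by rw [hloc]; exact hσ s⟩, hτ.smul_eq (g := g) (h := h) h₀ ?_⟩
  intro s a c
  rw [hloc, hσf]
  have := hfc s (lam.move s a c)
  rw [lam.colour_move] at this
  exact (Quotient.sound this).symm

theorem IsImplosion.exists_preimage (hτ : IsImplosion lam lam' τ)
    (h : lam'.universalGroup (fun s => quotientPermGroup (F s))) :
    ∃ g : lam.universalGroup F, ∀ c, h • τ c = τ (g • c) := by
  obtain ⟨c₀⟩ := B.nonempty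
  obtain ⟨d₀, hd₀⟩ := hτ.surjective (h • τ c₀)
  -- The local groups of `B'` act freely on the colours themselves, so the equivalence relation can
  -- be equality and `h` has constant local actions.
  have hσ := lam'.exists_colour_smul (r := fun _ => ⊥)
    (fun s f hf f' hf' a e b => by
      rw [quotientPermGroup_free hf hf' e]) h.2
  choose σ hσ hσc using hσ
  have hf : ∀ s, ∃ f ∈ F s, lam.colour d₀ s = f (lam.colour c₀ s) ∧
      ∀ (hs : s ∈ essentialTypes (fun s => plusSetoid (F s))) (a : Ω s),
        σ ⟨s, hs⟩ (Quotient.mk (plusSetoid (F s)) a) = Quotient.mk (plusSetoid (F s)) (f a) := by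
    intro s
    by_cases hs : s ∈ essentialTypes (fun s => plusSetoid (F s))
    · obtain ⟨f, hf, hfa⟩ := mem_quotientPermGroup_iff.1 (hσ ⟨s, hs⟩)
      have h1 : Quotient.mk (plusSetoid (F s)) (lam.colour d₀ s) =
          Quotient.mk (plusSetoid (F s)) (f (lam.colour c₀ s)) := by
        rw [← hfa, ← hτ.colour c₀ ⟨s, hs⟩, ← hτ.colour d₀ ⟨s, hs⟩, hd₀]
        exact hσc ⟨s, hs⟩ (τ c₀)
      obtain ⟨n, hn, hnd⟩ := plusSetoid_iff.1 (Quotient.exact h1)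
      -- A lift `f` of the local action sends the colour of `c₀` to the class of that of `d₀`. The
      -- correction `n` in `(F s)⁺` makes the colours match exactly without changing the action on
      -- classes.
      refine ⟨n * f, mul_mem n.2 hf, hnd.symm, fun _ a => ?_⟩
      rw [hfa]
      exact Quotient.sound ((plusSetoid (F s)).symm (plusSetoid_iff.2 ⟨n, hn, rfl⟩))
    · have hsub : Subsingleton (Quotient (plusSetoid (F s))) := not_nontrivial_iff_subsingleton.1 hs
      -- For an inessential type `(F s)⁺` is transitive, and only the colour at `d₀` has to be
      -- matched.
      obtain ⟨n, hn, hnd⟩ := plusSetoid_iff.1 (Quotient.exact (s := plusSetoid (F s))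
        (hsub.elim (Quotient.mk _ (lam.colour d₀ s)) (Quotient.mk _ (lam.colour c₀ s))))
      exact ⟨n, n.2, hnd.symm, fun hs' => absurd hs' hs⟩
  choose f hf hfc hσf using hf
  obtain ⟨g, hg, hloc, -⟩ := RightAngled.exists_twisted_aut lam f hfc
  refine ⟨⟨g, fun s c => by rw [hloc]; exact hf s⟩,
    hτ.smul_eq (g := g) (h := h) (c₀ := c₀) (by rw [hg, hd₀]; rfl) ?_⟩
  intro s a c
  rw [hloc, ← hσf s s.2 a]
  exact (hσc s _).trans (congrArg (σ s) (lam'.colour_move s _ _))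

theorem IsImplosion.apply_smul_of_mem_stabilizer (hτ : IsImplosion lam lam' τ)
    {g : lam.universalGroup F} {c : C}
    (hg : g • c = c) (d : C) : τ (g • d) = τ d := by
  have h := hτ.smul_eq (g := g) (h := 1) (c₀ := c) (by rw [one_smul]; exact congrArg τ hg.symm)
    (fun s a e => by
      rw [lam'.localAction_one]
      exact Quotient.sound ((plusSetoid (F s)).symm
        (lam.localAction_of_mem_stabilizersSubgroup (mem_stabilizersSubgroup hg) s e a))) d
  rw [one_smul] at h
  exact h.symm

/-- Since `g • c` and `c` lie in one fibre, `g • c = u • c` with `u` in the subgroup, and `u⁻¹ * g`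
stabilizes `c`. -/
theorem IsImplosion.mem_stabilizersSubgroup (hτ : IsImplosion lam lam' τ)
    {g : lam.universalGroup F} {c : C}
    (h : τ (g • c) = τ c) : g ∈ stabilizersSubgroup (lam.universalGroup F) C := by
  obtain ⟨u, hu, huc⟩ := chamberOrbit_eq_iff.1 (hτ.chamberOrbit_eq h)
  have h1 : u⁻¹ * g ∈ stabilizersSubgroup (lam.universalGroup F) C :=
    _root_.mem_stabilizersSubgroup (a := c) (by rw [mul_smul, ← huc, inv_smul_smul])
  have := mul_mem hu h1
  rwa [mul_inv_cancel_left] at this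

/-- An implosion induces an epimorphism of universal groups. -/
theorem IsImplosion.exists_monoidHom (hτ : IsImplosion lam lam' τ) :
    ∃ ψ : lam.universalGroup F →* lam'.universalGroup (fun s => quotientPermGroup (F s)),
      (∀ g c, ψ g • τ c = τ (g • c)) ∧
      (∀ f : lam.universalGroup F → lam'.universalGroup (fun s => quotientPermGroup (F s)),
        (∀ g c, f g • τ c = τ (g • c)) → f = ψ) ∧
      Function.Surjective ψ ∧ ψ.ker = stabilizersSubgroup (lam.universalGroup F) C := by
  -- Surjectivity of `τ` makes the intertwining relation determine the image; uniqueness and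
  -- multiplicativity of `ψ` both follow.
  have ext : ∀ h h' : lam'.universalGroup (fun s => quotientPermGroup (F s)),
      (∀ c, h • τ c = h' • τ c) → h = h' := by
    intro h h' H
    refine Subtype.ext (Subtype.ext (Equiv.ext fun c' => ?_))
    obtain ⟨c, rfl⟩ := hτ.surjective c'
    exact H c
  choose ψ hψ using hτ.exists_image
  let Ψ : lam.universalGroup F →* lam'.universalGroup (fun s => quotientPermGroup (F s)) :=
    MonoidHom.mk' ψ fun g g' => ext _ _ fun c => by rw [hψ, mul_smul, mul_smul, hψ, hψ]
  refine ⟨Ψ, hψ, fun f hf => funext fun g => ext _ _ fun c => (hf g c).trans (hψ g c).symm,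
    fun h => ?_, le_antisymm (fun g hg => ?_) (iSup_le fun c g hg => ?_)⟩
  · obtain ⟨g, hg⟩ := hτ.exists_preimage h
    exact ⟨g, ext _ _ fun c => (hψ g c).trans (hg c).symm⟩
  · obtain ⟨c⟩ := B.nonempty
    refine hτ.mem_stabilizersSubgroup (c := c) ?_
    rw [← hψ, show ψ g = 1 from hg, one_smul]
  · refine ext _ _ fun d => (hψ g d).trans ?_
    rw [one_smul, hτ.apply_smul_of_mem_stabilizer (MulAction.mem_stabilizer_iff.1 hg)]

end UniversalGroup

end

theorem theorem3p14 {S : Type u} [Finite S] (Γ : SimpleGraph S) {C : Type v} {Ω : S → Type w}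
    (B : Building (rightAngledMatrix Γ) C) (lam : LegalColouring B Ω)
    (F : ∀ s, Subgroup (Equiv.Perm (Ω s))) {C' : Type x}
    (B' : Building (implodedMatrix Γ (fun s => plusSetoid (F s))) C')
    (lam' : LegalColouring B' (ImplodedColours (fun s => plusSetoid (F s)))) :
    -- the implosion exists and is unique, for every admissible choice of base chambers
    (∀ c₀ : C, (∃ c₀' : C', SameColours lam lam' c₀ c₀') ∧
      ∀ c₀' : C', SameColours lam lam' c₀ c₀' →
        ∃! τ : C → C', IsImplosion lam lam' τ ∧ τ c₀ = c₀') ∧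
    -- every implosion induces an epimorphism with the asserted kernel
    (∀ τ : C → C', IsImplosion lam lam' τ →
      ∃ ψ : lam.universalGroup F →*
          lam'.universalGroup (fun s => quotientPermGroup (F s)),
        (∀ g c, ψ g • τ c = τ (g • c)) ∧
        (∀ f : lam.universalGroup F → lam'.universalGroup (fun s => quotientPermGroup (F s)),
          (∀ g c, f g • τ c = τ (g • c)) → f = ψ) ∧
        Function.Surjective ψ ∧
        ψ.ker = stabilizersSubgroup (lam.universalGroup F) C) ∧
    Nonempty (lam.universalGroup F ⧸ stabilizersSubgroup (lam.universalGroup F) C ≃*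
      lam'.universalGroup (fun s => quotientPermGroup (F s))) := by
  have part₁ : ∀ c₀ : C, (∃ c₀' : C', SameColours lam lam' c₀ c₀') ∧
      ∀ c₀' : C', SameColours lam lam' c₀ c₀' →
        ∃! τ : C → C', IsImplosion lam lam' τ ∧ τ c₀ = c₀' := fun c₀ =>
    ⟨lam'.exists_colour_eq _, fun _ h => existsUnique_isImplosion h⟩
  have part₂ := fun (τ : C → C') (hτ : IsImplosion lam lam' τ) => hτ.exists_monoidHom
  refine ⟨part₁, part₂, ?_⟩
  obtain ⟨c₀⟩ := B.nonempty
  obtain ⟨⟨c₀', h₀⟩, h⟩ := part₁ c₀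
  obtain ⟨τ, ⟨hτ, -⟩, -⟩ := h c₀' h₀
  obtain ⟨ψ, -, -, hsurj, hker⟩ := part₂ τ hτ
  exact ⟨(QuotientGroup.quotientMulEquivOfEq hker.symm).trans
    (QuotientGroup.quotientKerEquivOfSurjective ψ hsurj)⟩
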